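/- Let a Kac–Moody root datum be given: a finite set $I$, a lattice $P$ (the coweights, free of finite rank), linearly independent simple roots $\alpha_i\in P^*=\mathrm{Hom}(P,\mathbb Z)$ and simple coroots $\alpha_i^\vee\in P$ $(i\in I)$ such that $(\langle\alpha_i,\alpha_j^\vee\rangle)$ is a generalized Cartan matrix. Let $W\subset GL(P)$ be the Weyl group, generated by $s_i(\mu)=\mu-\langle\alpha_i,\mu\rangle\alpha_i^\vee$; let $\Delta^+$ be the set of positive real roots, $P^+$ the set of dominant coweights, $\mathcal T=W\cdot P^+$ the Tits cone, and $W_{\mathcal T}=\{\pi^\mu w: \mu\in\mathcal T,\ w\in W\}=W\ltimes\mathcal T$. Let $\rho:P\to\mathbb Q$ be additive with $\langle\rho,\alpha_i^\vee\rangle=1$ for all $i$, and let $N\ge 1$ be an integer with $N\langle\rho,\mu\rangle\in\mathbb Z$ for all $\mu\in P$. Put $\mathrm{Inv}(w)=\{\eta\in\Delta^+ : w\eta\in-\Delta^+\}$ and $$\ell(\pi^\mu w)=2\langle\rho,\mu\rangle+\sum_{\eta\in\Delta^+}\ell_\eta,\qquad \ell_\eta=\begin{cases}-2\langle\eta,\mu\rangle-[\eta\in\mathrm{Inv}(w^{-1})]&\text{if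 }\langle\eta,\mu\rangle<0,\\ [\eta\in\mathrm{Inv}(w^{-1})]&\text{if }\langle\eta,\mu\rangle\ge 0,\end{cases}$$ where $[\,\cdot\,]$ is $1$ or $0$ according to whether the condition holds; the sum has finitely many nonzero terms and $\ell$ takes values in $\frac1N\mathbb Z$. Let $\mathcal H$ be the Kac–Moody affine Hecke algebra: the unital $\mathbb Z[q^{1/N},q^{-1/N}]$-algebra generated by $T_i$ $(i\in I)$ and $\Theta^\mu$ $(\mu\in\mathcal T)$ with relations $T_i^2=(q-1)T_i+q$, the braid relations of $W$, $\Theta^0=1$, $\Theta^{\mu}\Theta^{\nu}=\Theta^{\mu+\nu}$, and $$T_i\Theta^\mu-\Theta^{s_i(\mu)}T_i=(q-1)\frac{\Theta^\mu-\Theta^{s_i(\mu)}}{1-\Theta^{-\alpha_i^\vee}}.$$ For $x=\pi^{w(\lambda)}v\in W_{\mathcal T}$ with $\lambda\in P^+$, $w,v\in W$, and a decomposition $v=s_{i_1}\cdots s_{i_r}$, the element $T_x\in\mathcal H$ is $$T_x=q^{\langle\rho,\lambda\rangle}\,T_{w^{-1}}^{-1}\,\Theta^\lambda\,T_{w^{-1}}\,T_{i_1}^{\varepsilon_1}\cdots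 T_{i_r}^{\varepsilon_r},$$ where $T_{w^{-1}}=T_{j_1}\cdots T_{j_m}$ for a reduced decomposition $w^{-1}=s_{j_1}\cdots s_{j_m}$, and $\varepsilon_k=1$ if the affine root $\pi^{w(\lambda)}s_{i_1}\cdots s_{i_{k-1}}(\alpha_{i_k})$ is positive and $\varepsilon_k=-1$ otherwise. Here $\pi^\mu w(\beta+n\pi)=w\beta+(n+\langle\mu,w\beta\rangle)\pi$, and for a real root $\beta$ the affine root $\beta+n\pi$ is positive iff $\beta\in\Delta^+$, $n\ge0$ or $-\beta\in\Delta^+$, $n>0$. Then: (a) There is a homomorphism of $\mathbb Z[q^{\pm1/N}]$-algebras $\mathrm{sign}:\mathcal H\to\mathbb Z[e^{\pi i/N}][q^{1/N},q^{-1/N}]$ with $$T_i\mapsto-1,\qquad \Theta^\mu\mapsto e^{2\pi i\langle\rho,\mu\rangle}q^{-\langle\rho,\mu\rangle}\qquad(i\in I,\ \mu\in\mathcal T).$$ It satisfies $\mathrm{sign}(T_x)=e^{\pi i\,\ell(x)}$ for every $x\in W_{\mathcal T}$, whichever $\lambda,w$ and decompositions are used to express $T_x$; in particular $\mathrm{sign}(T_x)=(-1)^{\ell(x)}$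 whenever $\ell(x)\in\mathbb Z$. It is the only $\mathbb Z[q^{\pm1/N}]$-algebra homomorphism from $\mathcal H$ to this ring with $T_x\mapsto e^{\pi i\,\ell(x)}$ for all $x\in W_{\mathcal T}$. (b) There is a ring homomorphism $\mathcal H\to\mathbb Z[e^{\pi i/N}][q^{1/N},q^{-1/N}]$ (semilinear over $q^{1/N}\mapsto e^{\pi i/N}$) with $T_i\mapsto -1$ and $\Theta^\mu\mapsto e^{\pi i\langle\rho,\mu\rangle}$, and it also sends $T_x$ to $e^{\pi i\,\ell(x)}$ for every $x\in W_{\mathcal T}$, again for every choice in the expression of $T_x$. -/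

import Mathlib

open LaurentPolynomial

noncomputable section

/-- A Kac-Moody root datum with index set `I` (the nodes of the Dynkin diagram) and coweight
lattice `P`: simple roots in the dual lattice of `P` and simple coroots in `P` whose pairings form
a generalized Cartan matrix, the simple roots being linearly independent. Independence of the
coroots and minimality of the rank of `P` are not needed, so they are not imposed. -/
structure KMRootDatum (I P : Type*) [AddCommGroup P] where
  root : I → Module.Dual ℤ P
  coroot : I → P
  root_coroot_two : ∀ i, root i (coroot i) = 2
  root_coroot_nonpos : ∀ i j, i ≠ j → root i (coroot j) ≤ 0
  root_coroot_zero : ∀ i j, root i (coroot j) = 0 → root j (coroot i) = 0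
  linearIndependent_root : LinearIndependent ℤ root

/-- The coefficient ring `ℤ[e^{πi/N}]`, as a subring of `ℂ`. -/
abbrev SignCoeff (N : ℕ) : Subalgebra ℤ ℂ :=
  Algebra.adjoin ℤ {Complex.exp (Real.pi * Complex.I / N)}

/-- The ring `ℤ[e^{πi/N}][q^{1/N}, q^{-1/N}]`; the Laurent variable `T 1` is `q^{1/N}`. -/
abbrev SignRing (N : ℕ) : Type := LaurentPolynomial (SignCoeff N)

/-- `ℤ[e^{πi/N}][q^{±1/N}]` as an algebra over `ℤ[q^{±1/N}]`, with `q^{1/N} ↦ q^{1/N}`. -/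
instance SignRing.algebra (N : ℕ) : Algebra (LaurentPolynomial ℤ) (SignRing N) :=
  (AddMonoidAlgebra.mapRingHom ℤ (Int.castRingHom (SignCoeff N))).toAlgebra

theorem SignRing.algebraMap_T (N : ℕ) (n : ℤ) :
    algebraMap (LaurentPolynomial ℤ) (SignRing N) (T n) = T n := by
  change AddMonoidAlgebra.mapRingHom ℤ (Int.castRingHom (SignCoeff N)) (.single n 1) = .single n 1
  rw [AddMonoidAlgebra.mapRingHom_single, map_one]

theorem SignCoeff.exp_pow (N : ℕ) :
    Complex.exp (Real.pi * Complex.I / N) ^ (2 * N) = 1 := by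
  rcases Nat.eq_zero_or_pos N with rfl | h
  · simp
  · have hN : (N : ℂ) ≠ 0 := by exact_mod_cast h.ne'
    rw [← Complex.exp_nat_mul, ← Complex.exp_two_pi_mul_I]
    congr 1
    push_cast
    field_simp

/-- `e^{πi/N}` as a unit of `ℤ[e^{πi/N}]`. -/
def zetaUnit (N : ℕ) : (SignCoeff N)ˣ :=
  let z : SignCoeff N :=
    ⟨Complex.exp (Real.pi * Complex.I / N), Algebra.subset_adjoin (Set.mem_singleton _)⟩
  have hz : z ^ (2 * N) = 1 := Subtype.ext (SignCoeff.exp_pow N)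
  have h : z * z ^ (2 * N - 1) = 1 := by
    rcases Nat.eq_zero_or_pos N with h0 | h0
    · have h1 : z = 1 := Subtype.ext (by simp [z, h0])
      simp [h1]
    · rw [← pow_succ', Nat.sub_add_cancel (by omega), hz]
  ⟨z, z ^ (2 * N - 1), h, by rw [mul_comm, h]⟩

theorem coe_zetaUnit (N : ℕ) :
    (((zetaUnit N : (SignCoeff N)ˣ) : SignCoeff N) : ℂ) =
      Complex.exp (Real.pi * Complex.I / N) := rfl

/-- The element `e^{πi r}` of `ℤ[e^{πi/N}]` for `r ∈ (1/N)ℤ`; see `coe_expPi`. -/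
def expPi (N : ℕ) (r : ℚ) : SignCoeff N := ((zetaUnit N ^ ⌊(N : ℚ) * r⌋ : (SignCoeff N)ˣ))

theorem coe_expPi (N : ℕ) (hN : 1 ≤ N) (r : ℚ) (hr : ∃ k : ℤ, (N : ℚ) * r = k) :
    (expPi N r : ℂ) = Complex.exp (Real.pi * Complex.I * r) := by
  obtain ⟨k, hk⟩ := hr
  have hN' : (N : ℂ) ≠ 0 := by exact_mod_cast (by omega : N ≠ 0)
  have hfl : ⌊(N : ℚ) * r⌋ = k := by rw [hk, Int.floor_intCast]
  have hkC : (N : ℂ) * (r : ℂ) = k := by exact_mod_cast congrArg (fun t : ℚ => (t : ℂ)) hk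
  have h1 : (expPi N r : ℂ) = Complex.exp (Real.pi * Complex.I / N) ^ k := by
    rw [expPi, hfl]
    have := map_zpow (Units.map (SignCoeff N).val.toRingHom.toMonoidHom) (zetaUnit N) k
    have h2 := congrArg (fun u : ℂˣ => (u : ℂ)) this
    simp only [Units.val_zpow_eq_zpow_val] at h2
    exact h2
  rw [h1, ← Complex.exp_int_mul, ← hkC]
  congr 1
  field_simp

/-- The monomial `q^r` for `r ∈ (1/N)ℤ`, in Laurent polynomials in `q^{1/N}`. -/
def qPow {R : Type*} [Semiring R] (N : ℕ) (r : ℚ) : LaurentPolynomial R := T ⌊(N : ℚ) * r⌋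

namespace KMRootDatum

variable {I P : Type*} [AddCommGroup P] (D : KMRootDatum I P)

/-! ### Weyl group, real roots, Tits cone -/

/-- The simple reflection `s_i(μ) = μ - ⟨α_i, μ⟩ α_i` of the coweight lattice. -/
def simpleRefl (i : I) : P ≃ₗ[ℤ] P := Module.reflection (D.root_coroot_two i)

/-- The Weyl group `W`, acting on the coweight lattice. -/
def weyl : Subgroup (P ≃ₗ[ℤ] P) := Subgroup.closure (Set.range D.simpleRefl)

/-- The element `s_{i_1} ⋯ s_{i_r}` for the word `[i_1, …, i_r]`. -/
def wordProd (l : List I) : P ≃ₗ[ℤ] P := (l.map D.simpleRefl).prod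

/-- The word is a reduced decomposition of its product. -/
def IsReducedWord (l : List I) : Prop :=
  ∀ l' : List I, D.wordProd l' = D.wordProd l → l.length ≤ l'.length

/-- The action of the Weyl group on the dual lattice: `⟨w β, μ⟩ = ⟨β, w⁻¹ μ⟩`. -/
def dualAct (w : P ≃ₗ[ℤ] P) (β : Module.Dual ℤ P) : Module.Dual ℤ P :=
  β ∘ₗ (w⁻¹ : P ≃ₗ[ℤ] P).toLinearMap

/-- The set `Δ` of real roots. -/
def realRoots : Set (Module.Dual ℤ P) := {β | ∃ w ∈ D.weyl, ∃ i, β = dualAct w (D.root i)}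

/-- The set `Δ⁺` of positive real roots: the real roots that are nonnegative integral combinations
of simple roots. -/
def posRoots : Set (Module.Dual ℤ P) :=
  {β ∈ D.realRoots | β ∈ AddSubmonoid.closure (Set.range D.root)}

/-- The inversion set `Inv(w) = Δ⁺ ∩ w⁻¹(-Δ⁺)`. -/
def inv (w : P ≃ₗ[ℤ] P) : Set (Module.Dual ℤ P) :=
  {η ∈ D.posRoots | -(dualAct w η) ∈ D.posRoots}

/-- Dominant coweights. -/
def IsDominant (l : P) : Prop := ∀ i, 0 ≤ D.root i l

/-- The Tits cone: the `W`-orbits of the dominant coweights. -/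
def titsCone : Set P := {μ | ∃ w ∈ D.weyl, ∃ l, D.IsDominant l ∧ μ = w l}

theorem simpleRefl_mem (i : I) : D.simpleRefl i ∈ D.weyl :=
  Subgroup.subset_closure ⟨i, rfl⟩

theorem simpleRefl_mul_self (i : I) : D.simpleRefl i * D.simpleRefl i = 1 := by
  ext μ
  exact Module.involutive_reflection (D.root_coroot_two i) μ

theorem simpleRefl_inv (i : I) : (D.simpleRefl i)⁻¹ = D.simpleRefl i :=
  inv_eq_of_mul_eq_one_left (D.simpleRefl_mul_self i)

theorem wordProd_mem (l : List I) : D.wordProd l ∈ D.weyl := by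
  refine Subgroup.list_prod_mem _ fun x hx => ?_
  obtain ⟨i, -, rfl⟩ := List.mem_map.1 hx
  exact D.simpleRefl_mem i

theorem dominant_mem_titsCone {l : P} (hl : D.IsDominant l) : l ∈ D.titsCone :=
  ⟨1, one_mem _, l, hl, rfl⟩

theorem weyl_titsCone {w : P ≃ₗ[ℤ] P} (hw : w ∈ D.weyl) {μ : P} (hμ : μ ∈ D.titsCone) :
    w μ ∈ D.titsCone := by
  obtain ⟨v, hv, l, hl, rfl⟩ := hμ
  exact ⟨w * v, mul_mem hw hv, l, hl, rfl⟩

/-- `s_i(μ)` as an element of the Tits cone. -/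
def reflTits (i : I) (μ : D.titsCone) : D.titsCone :=
  ⟨D.simpleRefl i μ, D.weyl_titsCone (D.simpleRefl_mem i) μ.2⟩

theorem exists_reducedWord {w : P ≃ₗ[ℤ] P} (hw : w ∈ D.weyl) :
    ∃ l, D.wordProd l = w ∧ D.IsReducedWord l := by
  have hne : {l : List I | D.wordProd l = w}.Nonempty := by
    induction hw using Subgroup.closure_induction with
    | mem x hx =>
      obtain ⟨i, rfl⟩ := hx
      exact ⟨[i], by simp [wordProd]⟩
    | one => exact ⟨[], by simp [wordProd]⟩
    | mul x y _ _ hx hy =>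
      obtain ⟨l, hl⟩ := hx
      obtain ⟨m, hm⟩ := hy
      refine ⟨l ++ m, ?_⟩
      simp only [Set.mem_ofPred_eq, wordProd] at hl hm ⊢
      rw [List.map_append, List.prod_append, hl, hm]
    | inv x _ hx =>
      obtain ⟨l, hl⟩ := hx
      refine ⟨l.reverse, ?_⟩
      simp only [Set.mem_ofPred_eq, wordProd] at hl ⊢
      rw [← hl, List.prod_inv_reverse, List.map_map, List.map_reverse]
      congr 3
  obtain ⟨l, hl, hmin⟩ := (measure (List.length (α := I))).wf.has_min _ hne
  exact ⟨l, hl, fun l' hl' => not_lt.1 (hmin l' (hl'.trans hl))⟩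

/-! ### Affine roots, the semigroup `W ⋉ 𝒯` and its length function -/

/-- The action of `π^μ w` on affine roots, `β + nπ` being the pair `(β, n)`:
`π^μ w (β + nπ) = wβ + (n + ⟨μ, wβ⟩)π`. -/
def affAct (μ : P) (w : P ≃ₗ[ℤ] P) (b : Module.Dual ℤ P × ℤ) : Module.Dual ℤ P × ℤ :=
  (dualAct w b.1, b.2 + dualAct w b.1 μ)

/-- Positivity of the affine root `β + nπ`. -/
def AffPos (b : Module.Dual ℤ P × ℤ) : Prop :=
  (b.1 ∈ D.posRoots ∧ 0 ≤ b.2) ∨ (-b.1 ∈ D.posRoots ∧ 0 < b.2)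

/-- The elements `π^μ w`, with `μ` in the Tits cone and `w ∈ W`, of the semigroup `W ⋉ 𝒯`. -/
structure TitsWeyl where
  trans : D.titsCone
  lin : D.weyl

open Classical in
/-- The contribution of a positive real root `η` to the length of `π^μ w`. -/
def lengthTerm (x : D.TitsWeyl) (η : Module.Dual ℤ P) : ℤ :=
  if η (x.trans : P) < 0 then
    (if η ∈ D.inv (x.lin : P ≃ₗ[ℤ] P)⁻¹ then -(2 * η (x.trans : P)) - 1
      else -(2 * η (x.trans : P)))
  else (if η ∈ D.inv (x.lin : P ≃ₗ[ℤ] P)⁻¹ then 1 else 0)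

/-- The length `ℓ(π^μ w) = 2⟨ρ, μ⟩ + ∑_{η ∈ Δ⁺} (…)`. Only finitely many summands are nonzero,
as `μ` lies in the Tits cone. -/
def length (ρ : P →ₗ[ℤ] ℚ) (x : D.TitsWeyl) : ℚ :=
  2 * ρ (x.trans : P) + ((∑ᶠ η ∈ D.posRoots, D.lengthTerm x η : ℤ) : ℚ)

theorem length_mem (ρ : P →ₗ[ℤ] ℚ) (N : ℕ) (hρ : ∀ μ, ∃ k : ℤ, (N : ℚ) * ρ μ = k)
    (x : D.TitsWeyl) : ∃ k : ℤ, (N : ℚ) * D.length ρ x = k := by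
  obtain ⟨k, hk⟩ := hρ x.trans
  refine ⟨2 * k + N * ∑ᶠ η ∈ D.posRoots, D.lengthTerm x η, ?_⟩
  rw [length, Int.cast_add, Int.cast_mul, Int.cast_mul, ← hk]
  push_cast
  ring

/-! ### The Hecke algebra -/

/-- The free `ℤ[q^{±1/N}]`-algebra on symbols `T_i` (`i ∈ I`) and `Θ^μ` (`μ` in the Tits cone). -/
abbrev FreeHecke : Type _ := FreeAlgebra (LaurentPolynomial ℤ) (I ⊕ D.titsCone)

/-- The symbol `T_i`. -/
def freeT (i : I) : D.FreeHecke := FreeAlgebra.ι _ (Sum.inl i)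

/-- The symbol `Θ^μ`. -/
def freeΘ (μ : D.titsCone) : D.FreeHecke := FreeAlgebra.ι _ (Sum.inr μ)

/-- The parameter `q = (q^{1/N})^N`. -/
def q (N : ℕ) : LaurentPolynomial ℤ := T (N : ℤ)

/-- For an element `d = ∑ d_ν [ν]` supported on the Tits cone: `d` is the fraction
`(e^μ - e^{s_i μ}) / (1 - e^{-α_i})`, an identity in the group algebra `ℤ[P]`, which is a domain. (The
fraction is a signed sum of `e^ν` over lattice points `ν` between `μ` and `s_i μ`, and these
lie in the Tits cone; thus there is exactly one such `d`.) -/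
def IsBernsteinQuotient (i : I) (μ : D.titsCone) (d : D.titsCone →₀ ℤ) : Prop :=
  (d.sum fun ν c => (AddMonoidAlgebra.single (ν : P) c : AddMonoidAlgebra ℤ P)) *
      (1 - AddMonoidAlgebra.single (-D.coroot i) 1) =
    AddMonoidAlgebra.single (μ : P) 1 - AddMonoidAlgebra.single (D.simpleRefl i μ) 1

/-- The defining relations of the Kac-Moody affine Hecke algebra. -/
inductive HeckeRel (N : ℕ) : D.FreeHecke → D.FreeHecke → Prop
  | quadratic (i : I) :
      HeckeRel N (D.freeT i * D.freeT i) ((q N - 1) • D.freeT i + algebraMap _ _ (q N))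
  /-- The braid relation with `m = m_{ij}` the order of `s_i s_j` in `W`; it is void (`m = 0`) when
  the order is infinite. -/
  | braid (i j : I) (m : ℕ) (hm : m = orderOf (D.simpleRefl i * D.simpleRefl j)) :
      HeckeRel N (((CoxeterSystem.alternatingWord i j m).map D.freeT).prod)
        (((CoxeterSystem.alternatingWord j i m).map D.freeT).prod)
  | theta_zero (μ : D.titsCone) (hμ : (μ : P) = 0) : HeckeRel N (D.freeΘ μ) 1
  | theta_add (μ₁ μ₂ μ : D.titsCone) (hμ : (μ : P) = μ₁ + μ₂) :
      HeckeRel N (D.freeΘ μ₁ * D.freeΘ μ₂) (D.freeΘ μ)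
  | bernstein (i : I) (μ : D.titsCone) (d : D.titsCone →₀ ℤ)
      (hd : D.IsBernsteinQuotient i μ d) :
      HeckeRel N (D.freeT i * D.freeΘ μ - D.freeΘ (D.reflTits i μ) * D.freeT i)
        ((q N - 1) • d.sum fun ν c => c • D.freeΘ ν)

/-- The Kac-Moody affine Hecke algebra `ℋ`, over `ℤ[q^{1/N}, q^{-1/N}]`. -/
def Hecke (N : ℕ) : Type _ := RingQuot (D.HeckeRel N)

instance (N : ℕ) : Ring (D.Hecke N) := inferInstanceAs (Ring (RingQuot (D.HeckeRel N)))

instance (N : ℕ) : Algebra (LaurentPolynomial ℤ) (D.Hecke N) :=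
  inferInstanceAs (Algebra (LaurentPolynomial ℤ) (RingQuot (D.HeckeRel N)))

/-- The quotient map from the free algebra to `ℋ`. -/
def heckeMk (N : ℕ) : D.FreeHecke →ₐ[LaurentPolynomial ℤ] D.Hecke N :=
  RingQuot.mkAlgHom (LaurentPolynomial ℤ) (D.HeckeRel N)

/-- The generator `T_i` of `ℋ`. -/
def genT (N : ℕ) (i : I) : D.Hecke N := D.heckeMk N (D.freeT i)

/-- The generator `Θ^μ` of `ℋ`. -/
def genΘ (N : ℕ) (μ : D.titsCone) : D.Hecke N := D.heckeMk N (D.freeΘ μ)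

theorem heckeMk_rel (N : ℕ) {a b : D.FreeHecke} (h : D.HeckeRel N a b) : D.heckeMk N a = D.heckeMk N b :=
  RingQuot.mkAlgHom_rel (LaurentPolynomial ℤ) h

theorem genT_mul_self (N : ℕ) (i : I) :
    D.genT N i * D.genT N i = (q N - 1) • D.genT N i + (q N) • 1 := by
  have h := D.heckeMk_rel N (HeckeRel.quadratic i)
  rw [map_mul, map_add, map_smul, AlgHom.commutes, Algebra.algebraMap_eq_smul_one] at h
  exact h

/-- `T_i` as a unit of `ℋ`, with inverse `q⁻¹(T_i - (q - 1))`. -/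
def unitT (N : ℕ) (i : I) : (D.Hecke N)ˣ where
  val := D.genT N i
  inv := (T (-(N : ℤ)) : LaurentPolynomial ℤ) • (D.genT N i - (q N - 1) • 1)
  val_inv := by
    rw [mul_smul_comm, mul_sub, genT_mul_self, mul_smul_comm, mul_one, add_sub_cancel_left,
      smul_smul, q, ← T_add]
    simp
  inv_val := by
    rw [smul_mul_assoc, sub_mul, genT_mul_self, smul_mul_assoc, one_mul, add_sub_cancel_left,
      smul_smul, q, ← T_add]
    simp

/-- `T_{i_1} ⋯ T_{i_r}`; this is `T_w` when the word is a reduced decomposition of `w`. -/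
def wordT (N : ℕ) (l : List I) : (D.Hecke N)ˣ := (l.map (D.unitT N)).prod

open Classical in
/-- `T_{i_1}^{ε_1} ⋯ T_{i_r}^{ε_r}`, where `ε_k = 1` if
`π^μ v s_{i_1} ⋯ s_{i_{k-1}}(α_{i_k})` is positive, and `ε_k = -1` otherwise. -/
def signedWordT (N : ℕ) (μ : P) : (P ≃ₗ[ℤ] P) → List I → (D.Hecke N)ˣ
  | _, [] => 1
  | v, i :: l =>
      (if D.AffPos (affAct μ v (D.root i, 0)) then D.unitT N i else (D.unitT N i)⁻¹) *
        signedWordT N μ (v * D.simpleRefl i) l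

/-- The expression `q^{⟨ρ,λ⟩} T_{w⁻¹}⁻¹ Θ^λ T_{w⁻¹} T_{i_1}^{ε_1} ⋯ T_{i_r}^{ε_r}` for `λ` dominant,
with `u` a reduced word for `w⁻¹` and `l = [i_1, …, i_r]` a word for `v`. It represents
`T_x` for `x = π^{w(λ)} v`. -/
def tExpr (ρ : P →ₗ[ℤ] ℚ) (N : ℕ) (lam : P) (hlam : D.IsDominant lam) (u l : List I) :
    D.Hecke N :=
  (qPow N (ρ lam) : LaurentPolynomial ℤ) •
    ((((D.wordT N u)⁻¹ : (D.Hecke N)ˣ) : D.Hecke N) *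
      D.genΘ N ⟨lam, D.dominant_mem_titsCone hlam⟩ * (D.wordT N u : D.Hecke N) *
      (D.signedWordT N ((D.wordProd u)⁻¹ lam) 1 l : D.Hecke N))

/-- The data `(λ, u, l)` describes `x`: `x = π^{w(λ)} v` with `λ` dominant, `u` a reduced word
for `w⁻¹`, and `l` a word, not necessarily reduced, for `v`. -/
structure Decomposes (x : D.TitsWeyl) (lam : P) (u l : List I) : Prop where
  dominant : D.IsDominant lam
  reduced : D.IsReducedWord u
  trans_eq : (x.trans : P) = (D.wordProd u)⁻¹ lam
  lin_eq : (x.lin : P ≃ₗ[ℤ] P) = D.wordProd l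

theorem exists_decomposes (x : D.TitsWeyl) :
    ∃ (lam : P) (u l : List I), D.Decomposes x lam u l ∧ D.IsReducedWord l := by
  obtain ⟨w, hw, lam, hlam, hx⟩ := x.trans.2
  obtain ⟨u, hu, hur⟩ := D.exists_reducedWord (inv_mem hw)
  obtain ⟨l, hl, hlr⟩ := D.exists_reducedWord x.lin.2
  exact ⟨lam, u, l, ⟨hlam, hur, by rw [hx, hu, inv_inv], hl.symm⟩, hlr⟩

/-- The `T`-basis element `T_x`, computed from a chosen decomposition `x = π^{w(λ)} v`
and a chosen reduced word for `v`. -/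
def basisT (ρ : P →ₗ[ℤ] ℚ) (N : ℕ) (x : D.TitsWeyl) : D.Hecke N :=
  D.tExpr ρ N (D.exists_decomposes x).choose
    (D.exists_decomposes x).choose_spec.choose_spec.choose_spec.1.dominant
    (D.exists_decomposes x).choose_spec.choose
    (D.exists_decomposes x).choose_spec.choose_spec.choose

end KMRootDatum

end

noncomputable section

namespace KMRootDatum

variable {I P : Type*} [AddCommGroup P] (D : KMRootDatum I P)

/-! ### Length in the Weyl group -/

/-! Sending `T_i` to `-1` and `Θ^μ` to `χ(μ)`, for a character `χ` of the whole lattice, respects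
every relation as soon as `χ(-α_i^∨)` is the image of `q`. The quadratic relation reads `1 = -(q-1)
+ q`, the two sides of a braid relation have equally many letters, and the Bernstein relation
becomes the defining identity of its fraction evaluated at `χ` (`freeSign_rel`). Both homomorphisms
are of this kind: `χ(μ) = e^{2πi⟨ρ,μ⟩} q^{-⟨ρ,μ⟩}` with `q` kept, and `χ(μ) = e^{πi⟨ρ,μ⟩}` with `q ↦
-1`.

In a commutative target the conjugation by `T_{w⁻¹}` disappears, and the exponents `ε_k` do not
matter because `-1` is its own inverse. Hence `T_x` goes to `e^{2πi⟨ρ,λ⟩} (-1)^r` (`map_tExpr`). On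
the other side, `⟨ρ,w(λ)⟩` and `⟨ρ,λ⟩` differ by an integer, and modulo 2 the sum over positive
roots counts `Inv(v⁻¹)`, so that `ℓ(x) ≡ 2⟨ρ,λ⟩ + r` modulo 2 provided `|Inv(v⁻¹)| ≡ r`.

This parity is the substantial point. It holds because a simple reflection permutes the positive
real roots other than its own, which needs every real root to be positive or negative. That in turn
is proved by induction on word length, reducing to the dihedral group of two simple reflections
(`dualAct_root_mem_posCone`).

For uniqueness, the values on `T_{s_i} = T_i` and on translations by dominant `λ` determine the
images of `T_i` and `Θ^λ`. Every coweight is a difference of dominant ones, and the images of the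
`Θ` under the constructed homomorphism are units, so the remaining `Θ^μ` follow by cancellation. -/

theorem wordProd_nil : D.wordProd [] = 1 := rfl

theorem wordProd_cons (i : I) (l : List I) :
    D.wordProd (i :: l) = D.simpleRefl i * D.wordProd l := by
  simp [wordProd]

theorem wordProd_append (l l' : List I) :
    D.wordProd (l ++ l') = D.wordProd l * D.wordProd l' := by
  simp [wordProd]

theorem wordProd_singleton (i : I) : D.wordProd [i] = D.simpleRefl i := by
  simp [wordProd]

/-- The smallest length of a word for `w`. -/
def wordLen (w : P ≃ₗ[ℤ] P) : ℕ := sInf {n | ∃ l : List I, D.wordProd l = w ∧ l.length = n}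

theorem wordLen_wordProd_le (l : List I) : D.wordLen (D.wordProd l) ≤ l.length :=
  Nat.sInf_le ⟨l, rfl, rfl⟩

theorem exists_word_length_eq {w : P ≃ₗ[ℤ] P} (hw : w ∈ D.weyl) :
    ∃ l : List I, D.wordProd l = w ∧ l.length = D.wordLen w := by
  obtain ⟨l, hl, -⟩ := D.exists_reducedWord hw
  exact Nat.sInf_mem (s := {n | ∃ l : List I, D.wordProd l = w ∧ l.length = n}) ⟨_, l, hl, rfl⟩

theorem wordLen_mul_wordProd_le {v : P ≃ₗ[ℤ] P} (hv : v ∈ D.weyl) (l : List I) :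
    D.wordLen (v * D.wordProd l) ≤ D.wordLen v + l.length := by
  obtain ⟨m, rfl, hm⟩ := D.exists_word_length_eq hv
  rw [← wordProd_append, ← hm, ← List.length_append]
  exact D.wordLen_wordProd_le _

theorem mul_simpleRefl_mul_simpleRefl (w : P ≃ₗ[ℤ] P) (i : I) :
    w * D.simpleRefl i * D.simpleRefl i = w := by
  rw [mul_assoc, simpleRefl_mul_self, mul_one]

/-- A nontrivial element of the Weyl group has a right descent. -/
theorem exists_wordLen_mul_simpleRefl_lt {w : P ≃ₗ[ℤ] P} (hw : w ∈ D.weyl) (h1 : w ≠ 1) :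
    ∃ j, D.wordLen (w * D.simpleRefl j) < D.wordLen w := by
  obtain ⟨l, rfl, hl⟩ := D.exists_word_length_eq hw
  rcases List.eq_nil_or_concat l with rfl | ⟨l', j, rfl⟩
  · exact absurd rfl h1
  · refine ⟨j, ?_⟩
    rw [← hl, List.concat_eq_append, wordProd_append, wordProd_singleton, mul_simpleRefl_mul_simpleRefl]
    exact (D.wordLen_wordProd_le l').trans_lt (by simp)

/-! ### The action on the dual lattice -/

theorem dualAct_apply (w : P ≃ₗ[ℤ] P) (β : Module.Dual ℤ P) (μ : P) :
    dualAct w β μ = β (w⁻¹ μ) := rfl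

theorem dualAct_one (β : Module.Dual ℤ P) : dualAct 1 β = β := rfl

theorem dualAct_mul (w v : P ≃ₗ[ℤ] P) (β : Module.Dual ℤ P) :
    dualAct (w * v) β = dualAct w (dualAct v β) := by
  ext μ
  simp only [dualAct_apply, mul_inv_rev]
  rfl

theorem dualAct_add (w : P ≃ₗ[ℤ] P) (β γ : Module.Dual ℤ P) :
    dualAct w (β + γ) = dualAct w β + dualAct w γ := rfl

theorem dualAct_neg (w : P ≃ₗ[ℤ] P) (β : Module.Dual ℤ P) :
    dualAct w (-β) = -dualAct w β := rfl

theorem dualAct_zsmul (w : P ≃ₗ[ℤ] P) (c : ℤ) (β : Module.Dual ℤ P) :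
    dualAct w (c • β) = c • dualAct w β := rfl

theorem dualAct_inv_dualAct (w : P ≃ₗ[ℤ] P) (β : Module.Dual ℤ P) :
    dualAct w⁻¹ (dualAct w β) = β := by
  rw [← dualAct_mul, inv_mul_cancel, dualAct_one]

theorem simpleRefl_apply (i : I) (μ : P) :
    D.simpleRefl i μ = μ - D.root i μ • D.coroot i :=
  Module.reflection_apply μ (D.root_coroot_two i)

theorem dualAct_simpleRefl (i : I) (β : Module.Dual ℤ P) :
    dualAct (D.simpleRefl i) β = β - β (D.coroot i) • D.root i := by
  ext μ
  rw [dualAct_apply, simpleRefl_inv, simpleRefl_apply]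
  simp [mul_comm]

theorem dualAct_simpleRefl_root (i : I) :
    dualAct (D.simpleRefl i) (D.root i) = -D.root i := by
  rw [dualAct_simpleRefl, root_coroot_two]
  module

theorem dualAct_simpleRefl_simpleRefl (i : I) (β : Module.Dual ℤ P) :
    dualAct (D.simpleRefl i) (dualAct (D.simpleRefl i) β) = β := by
  rw [← dualAct_mul, simpleRefl_mul_self, dualAct_one]

/-! ### Dihedral computations -/

open CoxeterSystem (alternatingWord)

theorem dualAct_simpleRefl_left {i j : I} {p : ℤ} (hp : D.root j (D.coroot i) = -p) (c d : ℤ) :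
    dualAct (D.simpleRefl i) (c • D.root i + d • D.root j) =
      (p * d - c) • D.root i + d • D.root j := by
  rw [dualAct_simpleRefl]
  simp only [LinearMap.add_apply, LinearMap.smul_apply, D.root_coroot_two, hp, smul_eq_mul]
  module

theorem dualAct_simpleRefl_right {i j : I} {r : ℤ} (hr : D.root i (D.coroot j) = -r) (c d : ℤ) :
    dualAct (D.simpleRefl j) (c • D.root i + d • D.root j) =
      c • D.root i + (r * c - d) • D.root j := by
  rw [dualAct_simpleRefl]
  simp only [LinearMap.add_apply, LinearMap.smul_apply, D.root_coroot_two, hr, smul_eq_mul]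
  module

theorem wordProd_alternatingWord_succ (i j : I) (k : ℕ) :
    D.wordProd (alternatingWord i j (k + 1)) =
      D.simpleRefl (if Even k then j else i) * D.wordProd (alternatingWord i j k) := by
  rw [CoxeterSystem.alternatingWord_succ', wordProd_cons]

theorem exists_alternatingWord_eq_append (i j : I) (m d : ℕ) :
    ∃ p : List I, p.length = d ∧ alternatingWord i j (m + d) = p ++ alternatingWord i j m := by
  induction d with
  | zero => exact ⟨[], rfl, rfl⟩
  | succ d ih =>
    obtain ⟨p, hp, h⟩ := ih
    exact ⟨(if Even (m + d) then j else i) :: p, by rw [List.length_cons, hp],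
      by rw [← add_assoc, CoxeterSystem.alternatingWord_succ', h, List.cons_append]⟩

/-- In a dihedral subgroup of infinite order, alternating words send simple roots to positive
combinations of simple roots. -/
theorem exists_dualAct_alternatingWord_of_four_le {i j : I} {p r : ℤ}
    (hp : D.root j (D.coroot i) = -p) (hr : D.root i (D.coroot j) = -r)
    (hp0 : 0 ≤ p) (hr0 : 0 ≤ r) (hpr : 4 ≤ p * r) (k : ℕ) :
    ∃ c d : ℤ, 0 ≤ c ∧ 0 ≤ d ∧
      dualAct (D.wordProd (alternatingWord i j k)) (D.root i) = c • D.root i + d • D.root j ∧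
      (if Even k then p * d ≤ 2 * c else r * c ≤ 2 * d) := by
  -- The last conjunct is the invariant: the pairing with the coroot of the reflection applied last
  -- is nonnegative. Since `4 ≤ p * r`, the pairing with the other coroot is then nonpositive, so
  -- the next reflection does not lower its coefficient.
  induction k with
  | zero => exact ⟨1, 0, by simp, by simp, by simp [wordProd, alternatingWord, dualAct_one], by simp⟩
  | succ k ih =>
    obtain ⟨c, d, hc, hd, h, hk⟩ := ih
    rw [wordProd_alternatingWord_succ, dualAct_mul, h]
    by_cases he : Even k
    · rw [if_pos he] at hk ⊢
      have h1 : 4 * d ≤ p * r * d := mul_le_mul_of_nonneg_right hpr hd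
      have h2 : r * (p * d) ≤ r * (2 * c) := mul_le_mul_of_nonneg_left hk hr0
      refine ⟨c, r * c - d, hc, by linarith, D.dualAct_simpleRefl_right hr c d, ?_⟩
      rw [if_neg (by simpa [Nat.even_add_one] using he)]
      linarith
    · rw [if_neg he] at hk ⊢
      have h1 : 4 * c ≤ p * r * c := mul_le_mul_of_nonneg_right hpr hc
      have h2 : p * (r * c) ≤ p * (2 * d) := mul_le_mul_of_nonneg_left hk hp0
      refine ⟨p * d - c, d, by linarith, hd, D.dualAct_simpleRefl_left hp c d, ?_⟩
      rw [if_pos (by simpa [Nat.even_add_one] using he)]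
      linarith

theorem simpleRefl_left_add {i j : I} {r : ℤ} (hr : D.root i (D.coroot j) = -r) (μ : P)
    (c d : ℤ) :
    D.simpleRefl i (μ + c • D.coroot i + d • D.coroot j) =
      μ + (r * d - c - D.root i μ) • D.coroot i + d • D.coroot j := by
  rw [simpleRefl_apply]
  simp only [map_add, map_smul, D.root_coroot_two, hr, smul_eq_mul]
  module

theorem simpleRefl_right_add {i j : I} {p : ℤ} (hp : D.root j (D.coroot i) = -p) (μ : P)
    (c d : ℤ) :
    D.simpleRefl j (μ + c • D.coroot i + d • D.coroot j) =
      μ + c • D.coroot i + (p * c - d - D.root j μ) • D.coroot j := by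
  rw [simpleRefl_apply]
  simp only [map_add, map_smul, D.root_coroot_two, hp, smul_eq_mul]
  module

/-- The coefficient pairs of `μ ↦ x μ`, `x` being the product of a word in two letters; `true`
stands for the letter `i` and `false` for the letter `j`. -/
def dihedralCoeff (p r a b : ℤ) : List Bool → ℤ × ℤ
  | [] => (0, 0)
  | true :: l => (r * (dihedralCoeff p r a b l).2 - (dihedralCoeff p r a b l).1 - a,
      (dihedralCoeff p r a b l).2)
  | false :: l => ((dihedralCoeff p r a b l).1,
      p * (dihedralCoeff p r a b l).1 - (dihedralCoeff p r a b l).2 - b)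

theorem wordProd_map_bool_apply {i j : I} {p r : ℤ} (hp : D.root j (D.coroot i) = -p)
    (hr : D.root i (D.coroot j) = -r) (μ : P) (l : List Bool) :
    D.wordProd (l.map fun t => if t then i else j) μ =
      μ + (dihedralCoeff p r (D.root i μ) (D.root j μ) l).1 • D.coroot i +
        (dihedralCoeff p r (D.root i μ) (D.root j μ) l).2 • D.coroot j := by
  induction l with
  | nil => simp [dihedralCoeff, wordProd_nil]
  | cons t l ih =>
    rw [List.map_cons, wordProd_cons]
    cases t
    · simpa [ih, dihedralCoeff] using D.simpleRefl_right_add hp μ _ _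
    · simpa [ih, dihedralCoeff] using D.simpleRefl_left_add hr μ _ _

/-- Reduces a relation between two reflections to polynomial identities in `a` and `b`, with no
assumption on the coroots beyond their pairings. -/
theorem wordProd_eq_of_dihedralCoeff_eq {i j : I} {p r : ℤ} (hp : D.root j (D.coroot i) = -p)
    (hr : D.root i (D.coroot j) = -r) {l l' : List Bool}
    (h : ∀ a b, dihedralCoeff p r a b l = dihedralCoeff p r a b l') :
    D.wordProd (l.map fun t => if t then i else j) =
      D.wordProd (l'.map fun t => if t then i else j) := by
  ext μ
  rw [D.wordProd_map_bool_apply hp hr, D.wordProd_map_bool_apply hp hr, h]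

/-- The alternative behind positivity of roots in rank two: the alternating word sends the simple
root to a positive combination, or it has a suffix that can be shortened. -/
theorem dualAct_alternatingWord_or {i j : I} (hij : i ≠ j) (k : ℕ) :
    (∃ c d : ℤ, 0 ≤ c ∧ 0 ≤ d ∧
      dualAct (D.wordProd (alternatingWord i j k)) (D.root i) = c • D.root i + d • D.root j) ∨
    ∃ m ≤ k, ∃ l : List I, l.length < m ∧
      D.wordProd (alternatingWord i j m) * D.simpleRefl i = D.wordProd l := by
  obtain ⟨p, hp⟩ : ∃ p, D.root j (D.coroot i) = -p := ⟨_, (neg_neg _).symm⟩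
  obtain ⟨r, hr⟩ : ∃ r, D.root i (D.coroot j) = -r := ⟨_, (neg_neg _).symm⟩
  have hp0 : 0 ≤ p := by have := D.root_coroot_nonpos j i hij.symm; omega
  have hr0 : 0 ≤ r := by have := D.root_coroot_nonpos i j hij; omega
  have hpr : p = 0 ↔ r = 0 := by
    constructor <;> intro h
    · have := D.root_coroot_zero j i (by omega); omega
    · have := D.root_coroot_zero i j (by omega); omega
  -- If `4 ≤ p * r`, positivity holds for every `k`. Otherwise `p * r` is 0, 1, 2 or 3, the finite
  -- dihedral types with `m = 2, 3, 4, 6`.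
  rcases le_or_gt 4 (p * r) with h4 | h4
  · obtain ⟨c, d, hc, hd, h, -⟩ :=
      D.exists_dualAct_alternatingWord_of_four_le hp hr hp0 hr0 h4 k
    exact Or.inl ⟨c, d, hc, hd, h⟩
  -- For `k ≥ m`, the alternating word of length `m` followed by `s_i` has `m + 1` letters, and the
  -- braid relation shortens it to `m - 1`. For `k < m` the coefficients `w0`, …, `w5` are explicit.
  have key : ∀ (m : ℕ) (l l' : List Bool), l'.length < m →
      (alternatingWord i j m) ++ [i] = l.map (fun t => if t then i else j) →
      (∀ a b, dihedralCoeff p r a b l = dihedralCoeff p r a b l') → m ≤ k →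
      ∃ m ≤ k, ∃ l : List I, l.length < m ∧
        D.wordProd (alternatingWord i j m) * D.simpleRefl i = D.wordProd l := by
    intro m l l' hl hw h hm
    refine ⟨m, hm, l'.map fun t => if t then i else j, by simpa using hl, ?_⟩
    rw [← wordProd_singleton, ← wordProd_append, hw]
    exact D.wordProd_eq_of_dihedralCoeff_eq hp hr h
  have w0 : dualAct (D.wordProd (alternatingWord i j 0)) (D.root i) =
      (1 : ℤ) • D.root i + (0 : ℤ) • D.root j := by
    simp [wordProd, alternatingWord, dualAct_one]
  have step : ∀ (n : ℕ) (c d : ℤ),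
      dualAct (D.wordProd (alternatingWord i j n)) (D.root i) = c • D.root i + d • D.root j →
      dualAct (D.wordProd (alternatingWord i j (n + 1))) (D.root i) =
        (if Even n then c else p * d - c) • D.root i +
          (if Even n then r * c - d else d) • D.root j := by
    intro n c d h
    rw [wordProd_alternatingWord_succ, dualAct_mul, h]
    split_ifs
    · exact D.dualAct_simpleRefl_right hr c d
    · exact D.dualAct_simpleRefl_left hp c d
  have w1 := step _ _ _ w0
  have w2 := step _ _ _ w1
  have w3 := step _ _ _ w2
  have w4 := step _ _ _ w3
  have w5 := step _ _ _ w4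
  have e2 : Even 2 := by decide
  have e3 : ¬ Even 3 := by decide
  have e4 : Even 4 := by decide
  simp only [Nat.reduceAdd, Even.zero, Nat.not_even_one, e2, e3, e4, if_true, if_false]
    at w1 w2 w3 w4 w5
  have hcases : (p = 0 ∧ r = 0) ∨ (p = 1 ∧ r = 1) ∨ (p = 1 ∧ r = 2) ∨ (p = 2 ∧ r = 1) ∨
      (p = 1 ∧ r = 3) ∨ (p = 3 ∧ r = 1) := by
    rcases hp0.eq_or_lt with h | h
    · exact Or.inl ⟨h.symm, hpr.1 h.symm⟩
    · have h' : 0 < r := lt_of_le_of_ne hr0 fun h0 => by rw [hpr.2 h0.symm] at h; omega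
      have : p < 4 := by nlinarith
      have : r < 4 := by nlinarith
      interval_cases p <;> interval_cases r <;> omega
  rcases hcases with ⟨rfl, rfl⟩ | ⟨rfl, rfl⟩ | ⟨rfl, rfl⟩ | ⟨rfl, rfl⟩ | ⟨rfl, rfl⟩ | ⟨rfl, rfl⟩
  · by_cases hk : 2 ≤ k
    · exact Or.inr (key 2 [true, false, true] [false]
        (by simp) (by simp [alternatingWord]) (fun a b => by ext <;> simp [dihedralCoeff]) hk)
    · interval_cases k
      · exact Or.inl ⟨_, _, by norm_num, by norm_num, w0⟩
      · exact Or.inl ⟨_, _, by norm_num, by norm_num, w1⟩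
  · by_cases hk : 3 ≤ k
    · exact Or.inr (key 3 [false, true, false, true] [true, false]
        (by simp) (by simp [alternatingWord]) (fun a b => by ext <;> simp [dihedralCoeff] <;> ring) hk)
    · interval_cases k
      · exact Or.inl ⟨_, _, by norm_num, by norm_num, w0⟩
      · exact Or.inl ⟨_, _, by norm_num, by norm_num, w1⟩
      · exact Or.inl ⟨_, _, by norm_num, by norm_num, w2⟩
  · by_cases hk : 4 ≤ k
    · exact Or.inr (key 4 [true, false, true, false, true] [false, true, false]
        (by simp) (by simp [alternatingWord]) (fun a b => by ext <;> simp [dihedralCoeff] <;> ring) hk)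
    · interval_cases k
      · exact Or.inl ⟨_, _, by norm_num, by norm_num, w0⟩
      · exact Or.inl ⟨_, _, by norm_num, by norm_num, w1⟩
      · exact Or.inl ⟨_, _, by norm_num, by norm_num, w2⟩
      · exact Or.inl ⟨_, _, by norm_num, by norm_num, w3⟩
  · by_cases hk : 4 ≤ k
    · exact Or.inr (key 4 [true, false, true, false, true] [false, true, false]
        (by simp) (by simp [alternatingWord]) (fun a b => by ext <;> simp [dihedralCoeff] <;> ring) hk)
    · interval_cases k
      · exact Or.inl ⟨_, _, by norm_num, by norm_num, w0⟩
      · exact Or.inl ⟨_, _, by norm_num, by norm_num, w1⟩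
      · exact Or.inl ⟨_, _, by norm_num, by norm_num, w2⟩
      · exact Or.inl ⟨_, _, by norm_num, by norm_num, w3⟩
  · by_cases hk : 6 ≤ k
    · exact Or.inr (key 6 [true, false, true, false, true, false, true] [false, true, false, true, false]
        (by simp) (by simp [alternatingWord]) (fun a b => by ext <;> simp [dihedralCoeff] <;> ring) hk)
    · interval_cases k
      · exact Or.inl ⟨_, _, by norm_num, by norm_num, w0⟩
      · exact Or.inl ⟨_, _, by norm_num, by norm_num, w1⟩
      · exact Or.inl ⟨_, _, by norm_num, by norm_num, w2⟩
      · exact Or.inl ⟨_, _, by norm_num, by norm_num, w3⟩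
      · exact Or.inl ⟨_, _, by norm_num, by norm_num, w4⟩
      · exact Or.inl ⟨_, _, by norm_num, by norm_num, w5⟩
  · by_cases hk : 6 ≤ k
    · exact Or.inr (key 6 [true, false, true, false, true, false, true] [false, true, false, true, false]
        (by simp) (by simp [alternatingWord]) (fun a b => by ext <;> simp [dihedralCoeff] <;> ring) hk)
    · interval_cases k
      · exact Or.inl ⟨_, _, by norm_num, by norm_num, w0⟩
      · exact Or.inl ⟨_, _, by norm_num, by norm_num, w1⟩
      · exact Or.inl ⟨_, _, by norm_num, by norm_num, w2⟩
      · exact Or.inl ⟨_, _, by norm_num, by norm_num, w3⟩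
      · exact Or.inl ⟨_, _, by norm_num, by norm_num, w4⟩
      · exact Or.inl ⟨_, _, by norm_num, by norm_num, w5⟩

/-! ### Positive and negative real roots -/

/-- The monoid of nonnegative integral combinations of the simple roots. -/
abbrev posCone : AddSubmonoid (Module.Dual ℤ P) := AddSubmonoid.closure (Set.range D.root)

theorem root_mem_posCone (i : I) : D.root i ∈ D.posCone :=
  AddSubmonoid.subset_closure ⟨i, rfl⟩

theorem zsmul_mem_posCone {β : Module.Dual ℤ P} (hβ : β ∈ D.posCone) {c : ℤ} (hc : 0 ≤ c) :
    c • β ∈ D.posCone := by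
  lift c to ℕ using hc
  rw [natCast_zsmul]
  exact nsmul_mem hβ c

/-- If `w` has no right descent at `i`, it sends the simple root `α_i` to a positive root. -/
theorem dualAct_root_mem_posCone {w : P ≃ₗ[ℤ] P} (hw : w ∈ D.weyl) {i : I}
    (hi : D.wordLen w ≤ D.wordLen (w * D.simpleRefl i)) :
    dualAct w (D.root i) ∈ D.posCone := by
  induction hn : D.wordLen w using Nat.strong_induction_on generalizing w i with
  | _ n ih =>
  subst hn
  by_cases h1 : w = 1
  · subst h1
    exact D.root_mem_posCone i
  obtain ⟨j, hj⟩ := D.exists_wordLen_mul_simpleRefl_lt hw h1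
  have hij : i ≠ j := by
    rintro rfl
    omega
  -- Split off from `w` the longest alternating suffix with additive lengths; it ends in the descent
  -- `j`. What remains, `v`, has no right descent at `i` or `j`.
  let S : Set ℕ := {k | ∃ v ∈ D.weyl, w = v * D.wordProd (alternatingWord i j k) ∧
    D.wordLen v + k = D.wordLen w}
  have hbdd : BddAbove S := ⟨D.wordLen w, by rintro k ⟨v, -, -, h⟩; omega⟩
  have hone : 1 ∈ S := by
    have hw' : w = w * D.simpleRefl j * D.wordProd (alternatingWord i j 1) := by
      simp [alternatingWord, wordProd_singleton, mul_simpleRefl_mul_simpleRefl]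
    have hv := mul_mem hw (D.simpleRefl_mem j)
    refine ⟨w * D.simpleRefl j, hv, hw', ?_⟩
    have := D.wordLen_mul_wordProd_le hv (alternatingWord i j 1)
    rw [← hw', CoxeterSystem.length_alternatingWord] at this
    omega
  obtain ⟨v, hv, hwv, hlen⟩ := Nat.sSup_mem ⟨1, hone⟩ hbdd
  have hmax : sSup S + 1 ∉ S := fun h => by have := le_csSup hbdd h; omega
  have hk1 : 1 ≤ sSup S := le_csSup hbdd hone
  generalize sSup S = k at *
  -- A descent of `v` at the next letter would lengthen the alternating suffix, against maximality.
  have hnext : ∀ t, (if Even k then j else i) = t →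
      D.wordLen v ≤ D.wordLen (v * D.simpleRefl t) := by
    intro t ht
    by_contra! hlt
    have hvt := mul_mem hv (D.simpleRefl_mem t)
    have hw' : w = v * D.simpleRefl t * D.wordProd (alternatingWord i j (k + 1)) := by
      rw [wordProd_alternatingWord_succ, ht, ← mul_assoc, mul_simpleRefl_mul_simpleRefl, hwv]
    refine hmax ⟨_, hvt, hw', ?_⟩
    have := D.wordLen_mul_wordProd_le hvt (alternatingWord i j (k + 1))
    rw [← hw', CoxeterSystem.length_alternatingWord] at this
    omega
  -- A descent of `v` at the first letter of the suffix would cancel that letter and give too short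
  -- a word for `w`.
  have hprev : ∀ t, (if Even k then i else j) = t →
      D.wordLen v ≤ D.wordLen (v * D.simpleRefl t) := by
    intro t ht
    by_contra! hlt
    have hvt := mul_mem hv (D.simpleRefl_mem t)
    obtain ⟨k, rfl⟩ : ∃ m, k = m + 1 := ⟨k - 1, by omega⟩
    have ht' : (if Even k then j else i) = t := by
      rw [← ht]
      by_cases he : Even k <;> simp [he, Nat.even_add_one]
    have hw' : w = v * D.simpleRefl t * D.wordProd (alternatingWord i j k) := by
      rw [hwv, wordProd_alternatingWord_succ, ht', mul_assoc]
    have := D.wordLen_mul_wordProd_le hvt (alternatingWord i j k)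
    rw [← hw', CoxeterSystem.length_alternatingWord] at this
    omega
  have hvi : D.wordLen v ≤ D.wordLen (v * D.simpleRefl i) := by
    by_cases he : Even k
    · exact hprev i (if_pos he)
    · exact hnext i (if_neg he)
  have hvj : D.wordLen v ≤ D.wordLen (v * D.simpleRefl j) := by
    by_cases he : Even k
    · exact hnext j (if_pos he)
    · exact hprev j (if_neg he)
  have hlt : D.wordLen v < D.wordLen w := by omega
  rcases D.dualAct_alternatingWord_or hij k with ⟨c, d, hc, hd, h⟩ | ⟨m, hm, l, hl, h⟩
  · rw [hwv, dualAct_mul, h, dualAct_add, dualAct_zsmul, dualAct_zsmul]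
    exact add_mem (D.zsmul_mem_posCone (ih _ hlt hv hvi rfl) hc)
      (D.zsmul_mem_posCone (ih _ hlt hv hvj rfl) hd)
  -- Shortening the suffix would make `w s_i` shorter than `w`, against `hi`.
  · exfalso
    obtain ⟨d, rfl⟩ := Nat.exists_eq_add_of_le hm
    obtain ⟨p, hp, hap⟩ := exists_alternatingWord_eq_append i j m d
    have hws : w * D.simpleRefl i = v * D.wordProd (p ++ l) := by
      rw [hwv, hap, wordProd_append, wordProd_append, ← h]
      simp only [mul_assoc]
    have := D.wordLen_mul_wordProd_le hv (p ++ l)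
    rw [← hws, List.length_append] at this
    omega

theorem dualAct_root_mem_or_neg_mem_posCone {w : P ≃ₗ[ℤ] P} (hw : w ∈ D.weyl) (i : I) :
    dualAct w (D.root i) ∈ D.posCone ∨ -dualAct w (D.root i) ∈ D.posCone := by
  rcases le_total (D.wordLen w) (D.wordLen (w * D.simpleRefl i)) with h | h
  · exact Or.inl (D.dualAct_root_mem_posCone hw h)
  · right
    have := D.dualAct_root_mem_posCone (mul_mem hw (D.simpleRefl_mem i)) (i := i)
      (by rwa [mul_simpleRefl_mul_simpleRefl])
    rwa [dualAct_mul, dualAct_simpleRefl_root, dualAct_neg] at this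

theorem exists_coeff_of_mem_posCone {β : Module.Dual ℤ P} (hβ : β ∈ D.posCone) :
    ∃ f : I →₀ ℤ, (∀ i, 0 ≤ f i) ∧ Finsupp.linearCombination ℤ D.root f = β := by
  induction hβ using AddSubmonoid.closure_induction with
  | mem x hx =>
    obtain ⟨i, rfl⟩ := hx
    refine ⟨Finsupp.single i 1, fun j => ?_, by simp⟩
    classical
    rw [Finsupp.single_apply]
    split_ifs <;> simp
  | zero => exact ⟨0, by simp, by simp⟩
  | add x y _ _ hx hy =>
    obtain ⟨f, hf, rfl⟩ := hx
    obtain ⟨g, hg, rfl⟩ := hy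
    exact ⟨f + g, fun i => add_nonneg (hf i) (hg i), map_add _ _ _⟩

theorem linearCombination_root_injective :
    Function.Injective (Finsupp.linearCombination ℤ D.root) :=
  D.linearIndependent_root

/-- Independence of the simple roots makes the coefficients of `β` and `-β` cancel; being
nonnegative, they vanish. -/
theorem eq_zero_of_mem_posCone {β : Module.Dual ℤ P} (h : β ∈ D.posCone)
    (h' : -β ∈ D.posCone) : β = 0 := by
  obtain ⟨f, hf, hfβ⟩ := D.exists_coeff_of_mem_posCone h
  obtain ⟨g, hg, hgβ⟩ := D.exists_coeff_of_mem_posCone h'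
  have hfg : f + g = 0 := D.linearCombination_root_injective (by rw [map_add, hfβ, hgβ]; simp)
  have : f = 0 := by
    ext i
    have h1 := DFunLike.congr_fun hfg i
    have h2 := hf i
    have h3 := hg i
    simp only [Finsupp.add_apply, Finsupp.zero_apply] at h1 ⊢
    omega
  rw [← hfβ, this, map_zero]

theorem root_mem_realRoots (i : I) : D.root i ∈ D.realRoots := ⟨1, one_mem _, i, rfl⟩

theorem root_mem_posRoots (i : I) : D.root i ∈ D.posRoots :=
  ⟨D.root_mem_realRoots i, D.root_mem_posCone i⟩

theorem dualAct_mem_realRoots {w : P ≃ₗ[ℤ] P} (hw : w ∈ D.weyl) {β : Module.Dual ℤ P}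
    (hβ : β ∈ D.realRoots) : dualAct w β ∈ D.realRoots := by
  obtain ⟨v, hv, i, rfl⟩ := hβ
  exact ⟨w * v, mul_mem hw hv, i, (dualAct_mul w v _).symm⟩

theorem neg_mem_realRoots {β : Module.Dual ℤ P} (hβ : β ∈ D.realRoots) : -β ∈ D.realRoots := by
  obtain ⟨v, hv, i, rfl⟩ := hβ
  exact ⟨v * D.simpleRefl i, mul_mem hv (D.simpleRefl_mem i), i, by
    rw [dualAct_mul, dualAct_simpleRefl_root, dualAct_neg]⟩

theorem mem_posRoots_or_neg_mem {β : Module.Dual ℤ P} (hβ : β ∈ D.realRoots) :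
    β ∈ D.posRoots ∨ -β ∈ D.posRoots := by
  have hneg := D.neg_mem_realRoots hβ
  obtain ⟨w, hw, i, rfl⟩ := id hβ
  exact (D.dualAct_root_mem_or_neg_mem_posCone hw i).imp (⟨hβ, ·⟩) (⟨hneg, ·⟩)

theorem ne_zero_of_mem_realRoots {β : Module.Dual ℤ P} (hβ : β ∈ D.realRoots) : β ≠ 0 := by
  obtain ⟨w, -, i, rfl⟩ := hβ
  intro h
  have h' := congrArg (dualAct w⁻¹) h
  rw [dualAct_inv_dualAct] at h'
  exact D.linearIndependent_root.ne_zero i h'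

theorem neg_notMem_posRoots {β : Module.Dual ℤ P} (hβ : β ∈ D.posRoots) : -β ∉ D.posRoots :=
  fun h => D.ne_zero_of_mem_realRoots hβ.1 (D.eq_zero_of_mem_posCone hβ.2 h.2)

theorem exists_coeff_of_mem_realRoots {β : Module.Dual ℤ P} (hβ : β ∈ D.realRoots) :
    ∃ f : I →₀ ℤ, Finsupp.linearCombination ℤ D.root f = β := by
  rcases D.mem_posRoots_or_neg_mem hβ with h | h
  · obtain ⟨f, -, hf⟩ := D.exists_coeff_of_mem_posCone h.2
    exact ⟨f, hf⟩
  · obtain ⟨f, -, hf⟩ := D.exists_coeff_of_mem_posCone h.2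
    exact ⟨-f, by rw [map_neg, hf, neg_neg]⟩

/-- The only positive real root that is a multiple of a simple root is the simple root. -/
theorem eq_root_of_eq_zsmul_root {β : Module.Dual ℤ P} (hβ : β ∈ D.realRoots) {i : I} {k : ℤ}
    (hk : 0 ≤ k) (h : β = k • D.root i) : β = D.root i := by
  obtain ⟨w, hw, j, rfl⟩ := hβ
  have h1 : D.root j = k • dualAct w⁻¹ (D.root i) := by
    rw [← dualAct_zsmul, ← h, dualAct_inv_dualAct]
  -- Moving back by `w⁻¹` writes `α_j` as `k` times an integral combination of simple roots, so `k`
  -- divides 1.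
  obtain ⟨g, hg⟩ := D.exists_coeff_of_mem_realRoots
    (D.dualAct_mem_realRoots (inv_mem hw) (D.root_mem_realRoots i))
  have h2 : Finsupp.single j 1 = k • g :=
    D.linearCombination_root_injective (by rw [map_smul, hg, ← h1]; simp)
  have h3 : 1 = k * g j := by simpa using DFunLike.congr_fun h2 j
  have h4 : k = 1 := by
    have : IsUnit k := .of_mul_eq_one _ h3.symm
    rcases Int.isUnit_iff.1 this with h | h <;> omega
  rw [h, h4, one_smul]

/-- A simple reflection permutes the positive real roots other than its own simple root. -/
theorem dualAct_simpleRefl_mem_posRoots {i : I} {η : Module.Dual ℤ P} (hη : η ∈ D.posRoots)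
    (hne : η ≠ D.root i) : dualAct (D.simpleRefl i) η ∈ D.posRoots := by
  rcases D.mem_posRoots_or_neg_mem (D.dualAct_mem_realRoots (D.simpleRefl_mem i) hη.1) with h | h
  · exact h
  exfalso
  apply hne
  obtain ⟨f, hf, hfη⟩ := D.exists_coeff_of_mem_posCone hη.2
  obtain ⟨g, hg, hgη⟩ := D.exists_coeff_of_mem_posCone h.2
  -- If `s_i η` were negative, then `η` and `-s_i η`, both nonnegative combinations, would add up to
  -- a multiple of `α_i`; so `η` itself would be such a multiple.
  have hfg : f + g = Finsupp.single i (η (D.coroot i)) := by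
    apply D.linearCombination_root_injective
    rw [map_add, hfη, hgη, dualAct_simpleRefl, Finsupp.linearCombination_single]
    module
  have hfi : f = Finsupp.single i (f i) := by
    ext j
    rcases eq_or_ne i j with rfl | hij
    · simp
    · have h1 := DFunLike.congr_fun hfg j
      have h2 := hf j
      have h3 := hg j
      rw [Finsupp.add_apply, Finsupp.single_eq_of_ne hij.symm] at h1
      rw [Finsupp.single_eq_of_ne hij.symm]
      omega
  refine D.eq_root_of_eq_zsmul_root hη.1 (hf i) ?_
  rw [← hfη, hfi, Finsupp.linearCombination_single]
  simp

/-! ### Inversions -/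

/-- `s_i` permutes the positive roots other than `α_i`, and `α_i` itself becomes an inversion
because `w α_i` is positive. -/
theorem inv_mul_simpleRefl {w : P ≃ₗ[ℤ] P} {i : I} (h : dualAct w (D.root i) ∈ D.posRoots) :
    D.inv (w * D.simpleRefl i) = insert (D.root i) (dualAct (D.simpleRefl i) '' D.inv w) := by
  ext η
  constructor
  · rintro ⟨hη, hη'⟩
    rw [dualAct_mul] at hη'
    by_cases hne : η = D.root i
    · exact Or.inl hne
    · exact Or.inr ⟨_, ⟨D.dualAct_simpleRefl_mem_posRoots hη hne, hη'⟩,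
        D.dualAct_simpleRefl_simpleRefl i η⟩
  · rintro (rfl | ⟨η, ⟨hη, hη'⟩, rfl⟩)
    · refine ⟨D.root_mem_posRoots i, ?_⟩
      rwa [dualAct_mul, dualAct_simpleRefl_root, dualAct_neg, neg_neg]
    · have hne : η ≠ D.root i := by
        rintro rfl
        exact D.neg_notMem_posRoots h hη'
      refine ⟨D.dualAct_simpleRefl_mem_posRoots hη hne, ?_⟩
      rwa [dualAct_mul, dualAct_simpleRefl_simpleRefl]

theorem finite_inv_mul_simpleRefl {w : P ≃ₗ[ℤ] P} {i : I}
    (h : dualAct w (D.root i) ∈ D.posRoots) :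
    ((D.inv (w * D.simpleRefl i)).Finite ↔ (D.inv w).Finite) ∧
      ((D.inv w).Finite → (D.inv (w * D.simpleRefl i)).ncard = (D.inv w).ncard + 1) := by
  have hinj : Function.Injective (dualAct (D.simpleRefl i)) :=
    Function.LeftInverse.injective (D.dualAct_simpleRefl_simpleRefl i)
  have hnot : D.root i ∉ dualAct (D.simpleRefl i) '' D.inv w := by
    rintro ⟨η, ⟨hη, -⟩, h'⟩
    have : η = -D.root i := by
      rw [← D.dualAct_simpleRefl_simpleRefl i η, h', dualAct_simpleRefl_root]
    exact D.neg_notMem_posRoots (D.root_mem_posRoots i) (this ▸ hη)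
  rw [D.inv_mul_simpleRefl h, Set.finite_insert, Set.finite_image_iff hinj.injOn]
  refine ⟨Iff.rfl, fun hfin => ?_⟩
  rw [Set.ncard_insert_of_notMem hnot (hfin.image _), Set.ncard_image_of_injective _ hinj]

theorem inv_one : D.inv 1 = ∅ := by
  ext η
  simp only [inv, dualAct_one, Set.mem_ofPred_eq, Set.mem_empty_iff_false, iff_false, not_and]
  exact D.neg_notMem_posRoots

/-- Each letter adds or removes exactly one inversion. The word need not be reduced, so only the
parity of its length is recovered. -/
theorem finite_inv_wordProd_inv (l : List I) :
    (D.inv (D.wordProd l)⁻¹).Finite ∧ Even ((D.inv (D.wordProd l)⁻¹).ncard + l.length) := by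
  induction l with
  | nil => simp [wordProd_nil, inv_one]
  | cons i l ih =>
    obtain ⟨hfin, heven⟩ := ih
    rw [wordProd_cons, mul_inv_rev, simpleRefl_inv, List.length_cons]
    have hw : (D.wordProd l)⁻¹ ∈ D.weyl := inv_mem (D.wordProd_mem l)
    generalize (D.wordProd l)⁻¹ = w at *
    rcases D.mem_posRoots_or_neg_mem (D.dualAct_mem_realRoots hw (D.root_mem_realRoots i)) with
      h | h
    · obtain ⟨h1, h2⟩ := D.finite_inv_mul_simpleRefl h
      refine ⟨h1.2 hfin, ?_⟩
      rw [h2 hfin]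
      grind
    · have h' : dualAct (w * D.simpleRefl i) (D.root i) ∈ D.posRoots := by
        rwa [dualAct_mul, dualAct_simpleRefl_root, dualAct_neg]
      obtain ⟨h1, h2⟩ := D.finite_inv_mul_simpleRefl h'
      rw [mul_simpleRefl_mul_simpleRefl] at h1 h2
      refine ⟨h1.1 hfin, ?_⟩
      have := h2 (h1.1 hfin)
      grind

/-! ### Dominant coweights -/

theorem nonneg_of_mem_posCone {β : Module.Dual ℤ P} (hβ : β ∈ D.posCone) {l : P}
    (hl : D.IsDominant l) : 0 ≤ β l := by
  induction hβ using AddSubmonoid.closure_induction with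
  | mem x hx =>
    obtain ⟨i, rfl⟩ := hx
    exact hl i
  | zero => rfl
  | add x y _ _ hx hy => exact add_nonneg hx hy

/-- Every orbit of the Weyl group contains at most one dominant coweight. -/
theorem eq_of_isDominant_apply {w : P ≃ₗ[ℤ] P} (hw : w ∈ D.weyl) {l : P} (hl : D.IsDominant l)
    (hwl : D.IsDominant (w l)) : w l = l := by
  induction hn : D.wordLen w using Nat.strong_induction_on generalizing w with
  | _ n ih =>
  subst hn
  by_cases h1 : w = 1
  · rw [h1]
    rfl
  obtain ⟨i, hi⟩ := D.exists_wordLen_mul_simpleRefl_lt hw h1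
  have hv := mul_mem hw (D.simpleRefl_mem i)
  have h := D.dualAct_root_mem_posCone hv (i := i)
    (by rw [mul_simpleRefl_mul_simpleRefl]; exact hi.le)
  -- At a right descent `i` the root `-w α_i` is positive. Pairing it with the dominant `w l` gives
  -- `⟨α_i, l⟩ ≤ 0`, so `s_i` fixes `l` and `w` may be replaced by `w s_i`.
  have h2 := D.nonneg_of_mem_posCone h hwl
  rw [dualAct_mul, dualAct_simpleRefl_root, dualAct_neg, LinearMap.neg_apply, dualAct_apply] at h2
  have h3 : (w⁻¹ : P ≃ₗ[ℤ] P) (w l) = l := w.symm_apply_apply l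
  rw [h3] at h2
  have h4 : D.root i l = 0 := le_antisymm (by omega) (hl i)
  have h5 : (w * D.simpleRefl i) l = w l := by
    rw [LinearEquiv.mul_apply, simpleRefl_apply, h4, zero_smul, sub_zero]
  rw [← h5]
  exact ih _ hi hv (by rwa [h5]) rfl

/-- There is a coweight on which all simple roots take the same positive value. -/
theorem exists_forall_root_eq_pos [Finite I] [Module.Free ℤ P] [Module.Finite ℤ P] :
    ∃ (ν : P) (n : ℤ), 0 < n ∧ ∀ i, D.root i ν = n := by
  classical
  have := Fintype.ofFinite I
  let b := Module.Free.chooseBasis ℤ P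
  let A : Matrix I (Module.Free.ChooseBasisIndex ℤ P) ℤ := .of fun i k => D.root i (b k)
  have hinj : ∀ v : I → ℤ, Matrix.vecMul v A = 0 → v = 0 := by
    intro v hv
    have h : ∑ i, v i • D.root i = 0 := by
      refine b.ext fun k => ?_
      simpa [A, Matrix.vecMul, dotProduct] using congrFun hv k
    exact funext (Fintype.linearIndependent_iff.1 D.linearIndependent_root v h)
  -- A Gram determinant of independent integral vectors: a kernel vector `v` of `A Aᵀ` satisfies `|v
  -- A|² = 0`.
  have hdet : (A * A.transpose).det ≠ 0 := by
    intro h0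
    obtain ⟨v, hv, hv0⟩ := Matrix.exists_mulVec_eq_zero_iff.2 h0
    refine hv (hinj v ?_)
    rw [← Matrix.mulVec_transpose]
    refine dotProduct_self_eq_zero.1 ?_
    rw [← Matrix.mulVec_mulVec] at hv0
    rw [Matrix.dotProduct_mulVec, Matrix.vecMul_transpose, hv0, zero_dotProduct]
  -- The adjugate avoids division; the extra factor `det` makes the common value `det²`, which is
  -- positive whatever the sign of `det`.
  let c := A.transpose.mulVec ((A * A.transpose).adjugate.mulVec fun _ => (A * A.transpose).det)
  refine ⟨∑ k, c k • b k, (A * A.transpose).det * (A * A.transpose).det,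
    mul_self_pos.2 hdet, fun i => ?_⟩
  have h1 : D.root i (∑ k, c k • b k) = A.mulVec c i := by
    simp [A, Matrix.mulVec, dotProduct, mul_comm]
  rw [h1]
  simp only [c, Matrix.mulVec_mulVec]
  rw [← Matrix.mul_assoc, Matrix.mul_adjugate]
  simp

/-- Every coweight is a difference of dominant coweights. -/
theorem exists_isDominant_add [Finite I] [Module.Free ℤ P] [Module.Finite ℤ P] (μ : P) :
    ∃ ν, D.IsDominant ν ∧ D.IsDominant (μ + ν) := by
  obtain ⟨ν, n, hn, hν⟩ := D.exists_forall_root_eq_pos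
  have := Fintype.ofFinite I
  refine ⟨(∑ j, |D.root j μ|) • ν, fun i => ?_, fun i => ?_⟩
  · rw [map_smul, hν, smul_eq_mul]
    exact mul_nonneg (Finset.sum_nonneg fun _ _ => abs_nonneg _) hn.le
  · rw [map_add, map_smul, hν, smul_eq_mul]
    have h1 : |D.root i μ| ≤ ∑ j, |D.root j μ| :=
      Finset.single_le_sum (f := fun j => |D.root j μ|) (fun _ _ => abs_nonneg _)
        (Finset.mem_univ i)
    have h2 := neg_abs_le (D.root i μ)
    nlinarith [abs_nonneg (D.root i μ)]

/-! ### Parity of the length -/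

theorem wordProd_reverse (l : List I) : D.wordProd l.reverse = (D.wordProd l)⁻¹ := by
  induction l with
  | nil => simp [wordProd_nil]
  | cons i l ih =>
    rw [List.reverse_cons, wordProd_append, ih, wordProd_singleton, wordProd_cons, mul_inv_rev,
      simpleRefl_inv]

theorem finite_inv {w : P ≃ₗ[ℤ] P} (hw : w ∈ D.weyl) : (D.inv w).Finite := by
  obtain ⟨l, rfl, -⟩ := D.exists_reducedWord hw
  rw [← inv_inv (D.wordProd l), ← wordProd_reverse]
  exact (D.finite_inv_wordProd_inv _).1

theorem mem_inv_of_neg {w : P ≃ₗ[ℤ] P} (hw : w ∈ D.weyl) {l : P} (hl : D.IsDominant l)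
    {η : Module.Dual ℤ P} (hη : η ∈ D.posRoots) (h : η (w l) < 0) : η ∈ D.inv w⁻¹ := by
  refine ⟨hη, (D.mem_posRoots_or_neg_mem
    (D.dualAct_mem_realRoots (inv_mem hw) hη.1)).resolve_left fun h' => ?_⟩
  have := D.nonneg_of_mem_posCone h'.2 hl
  rw [dualAct_apply, inv_inv] at this
  omega

/-- The sum in the definition of the length has finite support. -/
theorem finite_support_lengthTerm (x : D.TitsWeyl) :
    (D.posRoots ∩ Function.support (D.lengthTerm x)).Finite := by
  obtain ⟨w, hw, l, hl, hx⟩ := x.trans.2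
  -- For `μ = w(l)`, a nonzero term has `⟨η, μ⟩ < 0`, which forces `η ∈ Inv(w⁻¹)`, or has `η` in the
  -- inversion set of the linear part.
  refine ((D.finite_inv (inv_mem hw)).union (D.finite_inv (inv_mem x.lin.2))).subset ?_
  rintro η ⟨hη, hs⟩
  by_contra hnot
  rw [Set.mem_union, not_or] at hnot
  apply hs
  rw [lengthTerm, if_neg fun h => hnot.1 (D.mem_inv_of_neg hw hl hη (hx ▸ h)), if_neg hnot.2]

/-- Modulo 2 the terms `2⟨η, μ⟩` drop out, leaving the number of inversions, which has the parity of
the word length. -/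
theorem even_finsum_lengthTerm_add (x : D.TitsWeyl) {l : List I}
    (hl : (x.lin : P ≃ₗ[ℤ] P) = D.wordProd l) :
    Even ((∑ᶠ η ∈ D.posRoots, D.lengthTerm x η) + (l.length : ℤ)) := by
  classical
  obtain ⟨hfin, heven⟩ := D.finite_inv_wordProd_inv l
  rw [← hl] at hfin heven
  have hsub : D.inv (x.lin : P ≃ₗ[ℤ] P)⁻¹ ⊆ D.posRoots := fun η hη => hη.1
  have hF := (D.finite_support_lengthTerm x).union hfin
  have hsum : ∑ᶠ η ∈ D.posRoots, D.lengthTerm x η = ∑ η ∈ hF.toFinset, D.lengthTerm x η := by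
    refine finsum_mem_eq_sum_of_inter_support_eq _ ?_
    ext η
    simp only [Set.Finite.coe_toFinset, Set.mem_inter_iff, Set.mem_union]
    constructor
    · exact fun h => ⟨Or.inl h, h.2⟩
    · rintro ⟨h | h, h'⟩
      · exact h
      · exact ⟨hsub h, h'⟩
  have hcard : ((D.inv (x.lin : P ≃ₗ[ℤ] P)⁻¹).ncard : ℤ) =
      ∑ η ∈ hF.toFinset, if η ∈ D.inv (x.lin : P ≃ₗ[ℤ] P)⁻¹ then 1 else 0 := by
    rw [Finset.sum_boole, Set.ncard_eq_toFinset_card _ hfin]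
    congr 2
    ext η
    simp only [Set.Finite.mem_toFinset, Finset.mem_filter, Set.mem_union]
    tauto
  have hdiff : Even (∑ η ∈ hF.toFinset, D.lengthTerm x η +
      ((D.inv (x.lin : P ≃ₗ[ℤ] P)⁻¹).ncard : ℤ)) := by
    rw [hcard, ← Finset.sum_add_distrib]
    refine Finset.even_sum _ fun η _ => ?_
    rw [lengthTerm]
    split_ifs
    · exact ⟨-η x.trans, by ring⟩
    · exact ⟨-η x.trans, by ring⟩
    · exact ⟨1, rfl⟩
    · exact ⟨0, rfl⟩
  rw [hsum]
  have : Even (((D.inv (x.lin : P ≃ₗ[ℤ] P)⁻¹).ncard + l.length : ℕ) : ℤ) := by exact_mod_cast heven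
  push_cast at this
  grind

theorem exists_int_rho_apply {ρ : P →ₗ[ℤ] ℚ} (hρ : ∀ i, ρ (D.coroot i) = 1) (l : List I) (μ : P) :
    ∃ c : ℤ, ρ (D.wordProd l μ) = ρ μ + c := by
  induction l with
  | nil => exact ⟨0, by simp [wordProd_nil]⟩
  | cons i l ih =>
    obtain ⟨c, hc⟩ := ih
    refine ⟨c - D.root i (D.wordProd l μ), ?_⟩
    rw [wordProd_cons, LinearEquiv.mul_apply, simpleRefl_apply, map_sub, map_smul, hc, hρ]
    simp
    ring

end KMRootDatum

/-! ### Powers of `e^{πi/N}` -/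

theorem zetaUnit_pow {N : ℕ} (hN : 1 ≤ N) : zetaUnit N ^ N = -1 := by
  have hN' : (N : ℂ) ≠ 0 := by exact_mod_cast (by omega : N ≠ 0)
  ext
  push_cast
  rw [coe_zetaUnit, ← Complex.exp_nat_mul, mul_div_cancel₀ _ hN', Complex.exp_pi_mul_I]

theorem expPi_eq {N : ℕ} {r : ℚ} {k : ℤ} (h : (N : ℚ) * r = k) :
    expPi N r = (zetaUnit N ^ k : (SignCoeff N)ˣ) := by
  rw [expPi, h, Int.floor_intCast]

theorem qPow_eq {R : Type*} [Semiring R] {N : ℕ} {r : ℚ} {k : ℤ} (h : (N : ℚ) * r = k) :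
    (qPow N r : LaurentPolynomial R) = T k := by
  rw [qPow, h, Int.floor_intCast]

theorem isUnit_expPi (N : ℕ) (r : ℚ) : IsUnit (expPi N r) := Units.isUnit _

theorem expPi_add {N : ℕ} {r s : ℚ} (hr : ∃ k : ℤ, (N : ℚ) * r = k)
    (hs : ∃ k : ℤ, (N : ℚ) * s = k) : expPi N (r + s) = expPi N r * expPi N s := by
  obtain ⟨k, hk⟩ := hr
  obtain ⟨m, hm⟩ := hs
  rw [expPi_eq hk, expPi_eq hm, expPi_eq (k := k + m) (by push_cast; rw [mul_add, hk, hm]),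
    zpow_add, Units.val_mul]

theorem expPi_intCast {N : ℕ} (hN : 1 ≤ N) (n : ℤ) :
    expPi N n = (((-1 : ℤˣ) ^ n : ℤˣ) : ℤ) := by
  rw [expPi_eq (k := N * n) (by push_cast; rfl), zpow_mul, zpow_natCast, zetaUnit_pow hN]
  rcases Int.even_or_odd n with h | h
  · simp [h.neg_one_zpow]
  · simp [h.neg_one_zpow]

theorem expPi_natCast {N : ℕ} (hN : 1 ≤ N) (n : ℕ) : expPi N n = (-1) ^ n := by
  have := expPi_intCast hN n
  rw [Int.cast_natCast, zpow_natCast] at this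
  rw [this]
  push_cast
  rfl

theorem expPi_two_mul_intCast {N : ℕ} (hN : 1 ≤ N) (n : ℤ) : expPi N ((2 * n : ℤ) : ℚ) = 1 := by
  rw [expPi_intCast hN, (even_two_mul n).neg_one_zpow]
  simp

theorem qPow_add {R : Type*} [Semiring R] {N : ℕ} {r s : ℚ} (hr : ∃ k : ℤ, (N : ℚ) * r = k)
    (hs : ∃ k : ℤ, (N : ℚ) * s = k) :
    (qPow N (r + s) : LaurentPolynomial R) = qPow N r * qPow N s := by
  obtain ⟨k, hk⟩ := hr
  obtain ⟨m, hm⟩ := hs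
  rw [qPow_eq hk, qPow_eq hm, qPow_eq (k := k + m) (by push_cast; rw [mul_add, hk, hm]), T_add]

theorem isUnit_qPow {R : Type*} [Semiring R] (N : ℕ) (r : ℚ) :
    IsUnit (qPow N r : LaurentPolynomial R) := isUnit_T _

/-- The value `e^{πi ℓ(x)}` only depends on `λ` and on the parity of a word for the linear part
when `x = π^{w(λ)} v`. -/
theorem KMRootDatum.Decomposes.expPi_length {I P : Type*} [AddCommGroup P] {D : KMRootDatum I P}
    {ρ : P →ₗ[ℤ] ℚ} (hρ : ∀ i, ρ (D.coroot i) = 1) {N : ℕ} (hN : 1 ≤ N)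
    (hint : ∀ μ : P, ∃ k : ℤ, (N : ℚ) * ρ μ = k) {x : D.TitsWeyl} {lam : P} {u l : List I}
    (h : D.Decomposes x lam u l) :
    expPi N (D.length ρ x) = expPi N (2 * ρ lam) * (-1) ^ l.length := by
  obtain ⟨k, hk⟩ := hint lam
  have hlam : ∃ k : ℤ, (N : ℚ) * (2 * ρ lam) = k := ⟨2 * k, by push_cast; rw [← hk]; ring⟩
  have hint' : ∀ n : ℤ, ∃ k : ℤ, (N : ℚ) * (n : ℚ) = k := fun n => ⟨N * n, by push_cast; rfl⟩
  obtain ⟨c, hc⟩ := D.exists_int_rho_apply hρ u.reverse lam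
  rw [D.wordProd_reverse, ← h.trans_eq] at hc
  obtain ⟨m, hm⟩ := D.even_finsum_lengthTerm_add x h.lin_eq
  -- Here `⟨ρ, μ⟩ = ⟨ρ, λ⟩ + c` and the sum over positive roots is `2m - r`, with `r` the word
  -- length; writing `-r` as `-2r + r` isolates an even integer.
  have hlen : D.length ρ x = 2 * ρ lam + ((2 * (c + m - l.length) : ℤ) : ℚ) + (l.length : ℤ) := by
    have hm' : ((∑ᶠ η ∈ D.posRoots, D.lengthTerm x η : ℤ) : ℚ) = m + m - l.length := by
      rw [eq_sub_iff_add_eq]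
      exact_mod_cast hm
    rw [length, hc, hm']
    push_cast
    ring
  rw [hlen, expPi_add _ (hint' _), expPi_add hlam (hint' _), expPi_two_mul_intCast hN, mul_one,
    Int.cast_natCast, expPi_natCast hN]
  obtain ⟨a, ha⟩ := hlam
  obtain ⟨b, hb⟩ := hint' (2 * (c + m - l.length))
  exact ⟨a + b, by rw [mul_add, ha, hb]; push_cast; rfl⟩

theorem RingHom.map_mul_neg_one_pow {R S : Type*} [Ring R] [Ring S] (f : R →+* S) (a : R) (n : ℕ) :
    f (a * (-1) ^ n) = f a * (-1) ^ n := by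
  rw [map_mul, map_pow, map_neg, map_one]

namespace KMRootDatum

variable {I P : Type*} [AddCommGroup P] (D : KMRootDatum I P)

theorem coe_reflTits (i : I) (μ : D.titsCone) :
    (D.reflTits i μ : P) = D.simpleRefl i μ := rfl

/-! ### Characters of the Hecke algebra with `T_i ↦ -1` -/

section SignHom

variable {R : Type*} [CommRing R] [Algebra (LaurentPolynomial ℤ) R] {N : ℕ}

/-- The homomorphism from the free algebra with `T_i ↦ -1` and `Θ^μ ↦ χ(μ)`. -/
def freeSign (χ : Multiplicative P →* R) : D.FreeHecke →ₐ[LaurentPolynomial ℤ] R :=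
  FreeAlgebra.lift _ (Sum.elim (fun _ => -1) fun μ => χ (.ofAdd (μ : P)))

theorem freeSign_freeT (χ : Multiplicative P →* R) (i : I) : D.freeSign χ (D.freeT i) = -1 := by
  simp [freeSign, freeT]

theorem freeSign_freeΘ (χ : Multiplicative P →* R) (μ : D.titsCone) :
    D.freeSign χ (D.freeΘ μ) = χ (.ofAdd (μ : P)) := by
  simp [freeSign, freeΘ]

theorem freeSign_alternatingWord (χ : Multiplicative P →* R) (i j : I) (m : ℕ) :
    D.freeSign χ (((CoxeterSystem.alternatingWord i j m).map D.freeT).prod) = (-1) ^ m := by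
  have h : D.freeSign χ ∘ D.freeT = fun _ => -1 := funext (D.freeSign_freeT χ)
  rw [map_list_prod, List.map_map, h]
  simp

/-- `χ` lives on all of `P` because the Bernstein fraction is defined by an identity in `ℤ[P]`.
Applying `χ` turns its denominator into `1 - q`, which cancels the factor `q - 1` up to the sign
supplied by `T_i ↦ -1`. -/
theorem freeSign_rel {χ : Multiplicative P →* R}
    (hχ : ∀ i, χ (.ofAdd (-D.coroot i)) = algebraMap (LaurentPolynomial ℤ) R (q N))
    ⦃a b : D.FreeHecke⦄ (h : D.HeckeRel N a b) : D.freeSign χ a = D.freeSign χ b := by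
  induction h with
  | quadratic i =>
    rw [map_mul, map_add, map_smul, freeSign_freeT, AlgHom.commutes, Algebra.smul_def, map_sub,
      map_one]
    ring
  | braid i j m hm => rw [freeSign_alternatingWord, freeSign_alternatingWord]
  | theta_zero μ hμ =>
    rw [freeSign_freeΘ, hμ, ofAdd_zero, map_one, map_one]
  | theta_add μ₁ μ₂ μ hμ =>
    rw [map_mul, freeSign_freeΘ, freeSign_freeΘ, freeSign_freeΘ, hμ, ofAdd_add, map_mul]
  | bernstein i μ d hd =>
    have h := congrArg (AddMonoidAlgebra.lift ℤ R P χ) hd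
    simp only [map_mul, map_sub, map_one, AddMonoidAlgebra.lift_single, one_smul, hχ,
      map_finsuppSum] at h
    simp only [map_mul, map_sub, map_smul, freeSign_freeΘ, freeSign_freeT, map_finsuppSum,
      coe_reflTits, map_zsmul, Algebra.smul_def (A := R) (_ : LaurentPolynomial ℤ), map_one]
    linear_combination h

/-- The character of the Hecke algebra with `T_i ↦ -1` and `Θ^μ ↦ χ(μ)`. -/
def signHom (χ : Multiplicative P →* R)
    (hχ : ∀ i, χ (.ofAdd (-D.coroot i)) = algebraMap (LaurentPolynomial ℤ) R (q N)) :
    D.Hecke N →ₐ[LaurentPolynomial ℤ] R :=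
  RingQuot.liftAlgHom (LaurentPolynomial ℤ) ⟨D.freeSign χ, D.freeSign_rel hχ⟩

theorem signHom_heckeMk {χ : Multiplicative P →* R}
    (hχ : ∀ i, χ (.ofAdd (-D.coroot i)) = algebraMap (LaurentPolynomial ℤ) R (q N))
    (a : D.FreeHecke) : D.signHom χ hχ (D.heckeMk N a) = D.freeSign χ a :=
  RingQuot.liftAlgHom_mkAlgHom_apply (LaurentPolynomial ℤ) _ (D.freeSign_rel hχ) a

theorem signHom_genT {χ : Multiplicative P →* R}
    (hχ : ∀ i, χ (.ofAdd (-D.coroot i)) = algebraMap (LaurentPolynomial ℤ) R (q N)) (i : I) :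
    D.signHom χ hχ (D.genT N i) = -1 := by
  rw [genT, signHom_heckeMk, freeSign_freeT]

theorem signHom_genΘ {χ : Multiplicative P →* R}
    (hχ : ∀ i, χ (.ofAdd (-D.coroot i)) = algebraMap (LaurentPolynomial ℤ) R (q N))
    (μ : D.titsCone) : D.signHom χ hχ (D.genΘ N μ) = χ (.ofAdd (μ : P)) := by
  rw [genΘ, signHom_heckeMk, freeSign_freeΘ]

end SignHom

/-- Algebra homomorphisms from the Hecke algebra agree if they agree on generators. -/
theorem hecke_algHom_ext {R : Type*} [Ring R] [Algebra (LaurentPolynomial ℤ) R] {N : ℕ}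
    {f g : D.Hecke N →ₐ[LaurentPolynomial ℤ] R} (hT : ∀ i, f (D.genT N i) = g (D.genT N i))
    (hΘ : ∀ μ, f (D.genΘ N μ) = g (D.genΘ N μ)) : f = g := by
  refine RingQuot.ringQuot_ext' (LaurentPolynomial ℤ) f g (FreeAlgebra.hom_ext (funext ?_))
  rintro (i | μ)
  · exact hT i
  · exact hΘ μ

theorem genΘ_zero (N : ℕ) {μ : D.titsCone} (hμ : (μ : P) = 0) : D.genΘ N μ = 1 := by
  rw [genΘ, D.heckeMk_rel N (HeckeRel.theta_zero μ hμ), map_one]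

theorem genΘ_mul_genΘ (N : ℕ) {μ₁ μ₂ μ : D.titsCone} (hμ : (μ : P) = μ₁ + μ₂) :
    D.genΘ N μ₁ * D.genΘ N μ₂ = D.genΘ N μ := by
  simp only [genΘ, ← map_mul, D.heckeMk_rel N (HeckeRel.theta_add μ₁ μ₂ μ hμ)]

/-! ### Values on the elements `T_x` -/

section Values

variable {R : Type*} [CommRing R] {N : ℕ} {s : D.Hecke N →+* R}

theorem map_signedWordT (hs : ∀ i, s (D.genT N i) = -1) (μ : P) (v : P ≃ₗ[ℤ] P) (l : List I) :
    s (D.signedWordT N μ v l : D.Hecke N) = (-1) ^ l.length := by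
  have hunit : ∀ i, Units.map (s : D.Hecke N →* R) (D.unitT N i) = -1 := fun i =>
    Units.ext (hs i)
  have key : Units.map (s : D.Hecke N →* R) (D.signedWordT N μ v l) = (-1) ^ l.length := by
    induction l generalizing v with
    | nil => simp [signedWordT]
    | cons i l ih =>
      rw [signedWordT, map_mul, ih, List.length_cons, pow_succ']
      split_ifs
      · rw [hunit]
      · rw [map_inv, hunit, inv_neg_one]
  simpa using congrArg Units.val key

theorem map_tExpr (hs : ∀ i, s (D.genT N i) = -1) (ρ : P →ₗ[ℤ] ℚ) {lam : P}
    (hlam : D.IsDominant lam) (u l : List I) :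
    s (D.tExpr ρ N lam hlam u l) =
      s (algebraMap (LaurentPolynomial ℤ) (D.Hecke N) (qPow N (ρ lam))) *
        s (D.genΘ N ⟨lam, D.dominant_mem_titsCone hlam⟩) * (-1) ^ l.length := by
  have h : s ((D.wordT N u)⁻¹ : (D.Hecke N)ˣ) * s (D.wordT N u : D.Hecke N) = 1 := by
    rw [← map_mul, Units.inv_mul, map_one]
  rw [tExpr, Algebra.smul_def]
  simp only [map_mul, D.map_signedWordT hs]
  linear_combination
    (s (algebraMap (LaurentPolynomial ℤ) (D.Hecke N) (qPow N (ρ lam))) *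
      s (D.genΘ N ⟨lam, D.dominant_mem_titsCone hlam⟩) * (-1) ^ l.length) * h

/-- A character with `T_i ↦ -1` that sends `q^{⟨ρ,λ⟩} Θ^λ` to `e^{2πi⟨ρ,λ⟩}` sends `T_x` to
`e^{πi ℓ(x)}`. -/
theorem map_tExpr_eq_C_expPi {s : D.Hecke N →+* SignRing N} (hs : ∀ i, s (D.genT N i) = -1)
    {ρ : P →ₗ[ℤ] ℚ} (hρ : ∀ i, ρ (D.coroot i) = 1) (hN : 1 ≤ N)
    (hint : ∀ μ : P, ∃ k : ℤ, (N : ℚ) * ρ μ = k)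
    (hΘ : ∀ μ : D.titsCone, s (algebraMap (LaurentPolynomial ℤ) (D.Hecke N) (qPow N (ρ (μ : P)))) *
      s (D.genΘ N μ) = C (expPi N (2 * ρ (μ : P))))
    {x : D.TitsWeyl} {lam : P} {u l : List I} (h : D.Decomposes x lam u l) :
    s (D.tExpr ρ N lam h.dominant u l) = C (expPi N (D.length ρ x)) := by
  have h1 : s (algebraMap (LaurentPolynomial ℤ) (D.Hecke N) (qPow N (ρ lam))) *
      s (D.genΘ N ⟨lam, D.dominant_mem_titsCone h.dominant⟩) = C (expPi N (2 * ρ lam)) :=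
    hΘ ⟨lam, D.dominant_mem_titsCone h.dominant⟩
  rw [D.map_tExpr hs, h1, h.expPi_length hρ hN hint]
  exact (RingHom.map_mul_neg_one_pow _ _ _).symm

end Values

/-! ### Recovering the generators from the elements `T_x`; uniqueness -/

/-- The basis element `T_x` is computed from a decomposition of `x`. -/
theorem exists_basisT_eq (ρ : P →ₗ[ℤ] ℚ) (N : ℕ) (x : D.TitsWeyl) :
    ∃ (lam : P) (u l : List I) (h : D.Decomposes x lam u l), D.IsReducedWord l ∧
      D.basisT ρ N x = D.tExpr ρ N lam h.dominant u l :=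
  ⟨_, _, _, (D.exists_decomposes x).choose_spec.choose_spec.choose_spec.1,
    (D.exists_decomposes x).choose_spec.choose_spec.choose_spec.2, rfl⟩

theorem simpleRefl_injective : Function.Injective D.simpleRefl := by
  intro i j h
  by_contra hne
  have h1 := D.dualAct_simpleRefl_root i
  rw [h, dualAct_simpleRefl] at h1
  have h2 : Finsupp.single i 2 = Finsupp.single j (D.root i (D.coroot j)) := by
    apply D.linearCombination_root_injective
    rw [Finsupp.linearCombination_single, Finsupp.linearCombination_single, two_smul]
    rw [sub_eq_iff_eq_add] at h1
    nth_rw 1 [h1]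
    abel
  have h3 := DFunLike.congr_fun h2 i
  rw [Finsupp.single_eq_same, Finsupp.single_eq_of_ne hne] at h3
  exact two_ne_zero h3

theorem simpleRefl_ne_one (i : I) : D.simpleRefl i ≠ 1 := by
  intro h
  have h1 := D.dualAct_simpleRefl_root i
  rw [h, dualAct_one] at h1
  exact D.neg_notMem_posRoots (D.root_mem_posRoots i) (h1 ▸ D.root_mem_posRoots i)

theorem eq_singleton_of_isReducedWord {l : List I} {i : I} (hl : D.IsReducedWord l)
    (h : D.wordProd l = D.simpleRefl i) : l = [i] := by
  have hlen := hl [i] (by rw [h, wordProd_singleton])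
  match l, hlen with
  | [], _ => exact absurd h.symm (D.simpleRefl_ne_one i)
  | [j], _ =>
    rw [wordProd_singleton] at h
    rw [D.simpleRefl_injective h]

/-- The simple reflection `s_i` as an element of the semigroup `W ⋉ 𝒯`. -/
def reflTitsWeyl (i : I) : D.TitsWeyl where
  trans := ⟨0, D.dominant_mem_titsCone fun _ => (map_zero _).ge⟩
  lin := ⟨D.simpleRefl i, D.simpleRefl_mem i⟩

theorem basisT_reflTitsWeyl (ρ : P →ₗ[ℤ] ℚ) (N : ℕ) (i : I) :
    D.basisT ρ N (D.reflTitsWeyl i) = D.genT N i := by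
  obtain ⟨lam, u, l, h, hl, heq⟩ := D.exists_basisT_eq ρ N (D.reflTitsWeyl i)
  obtain rfl := D.eq_singleton_of_isReducedWord hl h.lin_eq.symm
  obtain rfl : lam = 0 :=
    ((D.wordProd u)⁻¹ : P ≃ₗ[ℤ] P).injective (by rw [← h.trans_eq, map_zero]; rfl)
  have hpos : D.AffPos (affAct (0 : P) 1 (D.root i, 0)) :=
    Or.inl ⟨D.root_mem_posRoots i, by simp [affAct]⟩
  rw [heq, tExpr, D.genΘ_zero N rfl]
  simp [signedWordT, hpos, qPow, unitT]

/-- The translation `π^μ` as an element of the semigroup `W ⋉ 𝒯`. -/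
def translation (μ : D.titsCone) : D.TitsWeyl := ⟨μ, 1⟩

/-- The decomposition chosen for `T_x` must use the same `λ`, since a Weyl orbit contains only one
dominant coweight. -/
theorem exists_basisT_translation_eq (ρ : P →ₗ[ℤ] ℚ) (N : ℕ) {lam : P} (hlam : D.IsDominant lam) :
    ∃ u l : List I, D.basisT ρ N (D.translation ⟨lam, D.dominant_mem_titsCone hlam⟩) =
      D.tExpr ρ N lam hlam u l := by
  obtain ⟨lam', u, l, h, -, heq⟩ :=
    D.exists_basisT_eq ρ N (D.translation ⟨lam, D.dominant_mem_titsCone hlam⟩)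
  have h1 : lam = (D.wordProd u)⁻¹ lam' := h.trans_eq
  obtain rfl : lam = lam' :=
    h1.trans (D.eq_of_isDominant_apply (inv_mem (D.wordProd_mem u)) h.dominant (h1 ▸ hlam))
  exact ⟨u, l, heq⟩

/-- A character with `T_i ↦ -1` is determined by its values on the basis elements `T_x`. -/
theorem algHom_eq_of_basisT_eq [Finite I] [Module.Free ℤ P] [Module.Finite ℤ P] {R : Type*}
    [CommRing R] [Algebra (LaurentPolynomial ℤ) R] (ρ : P →ₗ[ℤ] ℚ) {N : ℕ}
    {f g : D.Hecke N →ₐ[LaurentPolynomial ℤ] R} (hf : ∀ i, f (D.genT N i) = -1)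
    (hunit : ∀ μ, IsUnit (f (D.genΘ N μ)))
    (h : ∀ x, g (D.basisT ρ N x) = f (D.basisT ρ N x)) : g = f := by
  have hT : ∀ i, g (D.genT N i) = f (D.genT N i) := fun i => by
    rw [← D.basisT_reflTitsWeyl ρ, h]
  have hg : ∀ i, g (D.genT N i) = -1 := fun i => (hT i).trans (hf i)
  have hdom : ∀ lam (hlam : D.IsDominant lam),
      g (D.genΘ N ⟨lam, D.dominant_mem_titsCone hlam⟩) =
        f (D.genΘ N ⟨lam, D.dominant_mem_titsCone hlam⟩) := by
    intro lam hlam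
    obtain ⟨u, l, heq⟩ := D.exists_basisT_translation_eq ρ N hlam
    have h1 := h (D.translation ⟨lam, D.dominant_mem_titsCone hlam⟩)
    rw [heq] at h1
    have h2 := (D.map_tExpr (s := (g : D.Hecke N →+* R)) hg ρ hlam u l).symm.trans
      (h1.trans (D.map_tExpr (s := (f : D.Hecke N →+* R)) hf ρ hlam u l))
    simp only [RingHom.coe_coe, AlgHom.commutes] at h2
    -- Both values are `q^{⟨ρ,λ⟩}` times the image of `Θ^λ` times a sign; the outer factors are
    -- units.
    exact ((isUnit_qPow N _).map _).mul_left_cancel ((isUnit_neg_one.pow _).mul_right_cancel h2)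
  refine D.hecke_algHom_ext hT fun μ => ?_
  obtain ⟨ν, hν, hμν⟩ := D.exists_isDominant_add (μ : P)
  have hmul := D.genΘ_mul_genΘ N (μ₁ := μ) (μ₂ := ⟨ν, D.dominant_mem_titsCone hν⟩)
    (μ := ⟨μ + ν, D.dominant_mem_titsCone hμν⟩) rfl
  have h1 := congrArg g hmul
  rw [map_mul, hdom _ hν, hdom _ hμν, ← hmul, map_mul] at h1
  exact (hunit _).mul_right_cancel h1

end KMRootDatum

/-! ### The two specializations -/

section Specializations

variable {P : Type*} [AddCommGroup P] (ρ : P →ₗ[ℤ] ℚ) {N : ℕ}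

/-- The character `μ ↦ e^{2πi⟨ρ,μ⟩} q^{-⟨ρ,μ⟩}`. -/
def genericChar (hint : ∀ μ : P, ∃ k : ℤ, (N : ℚ) * ρ μ = k) : Multiplicative P →* SignRing N where
  toFun μ := C (expPi N (2 * ρ μ.toAdd)) * qPow N (-ρ μ.toAdd)
  map_one' := by simp [expPi, qPow]
  map_mul' μ ν := by
    have h2 : ∀ μ, ∃ k : ℤ, (N : ℚ) * (2 * ρ μ) = k := fun μ => by
      obtain ⟨k, hk⟩ := hint μ
      exact ⟨2 * k, by push_cast; rw [← hk]; ring⟩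
    have hneg : ∀ μ, ∃ k : ℤ, (N : ℚ) * (-ρ μ) = k := fun μ => by
      obtain ⟨k, hk⟩ := hint μ
      exact ⟨-k, by push_cast; rw [← hk]; ring⟩
    rw [toAdd_mul, map_add, mul_add, neg_add, expPi_add (h2 _) (h2 _), qPow_add (hneg _) (hneg _),
      map_mul]
    ring

/-- The character `μ ↦ e^{πi⟨ρ,μ⟩}`. -/
def specialChar (hint : ∀ μ : P, ∃ k : ℤ, (N : ℚ) * ρ μ = k) : Multiplicative P →* SignRing N where
  toFun μ := C (expPi N (ρ μ.toAdd))
  map_one' := by simp [expPi]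
  map_mul' μ ν := by rw [toAdd_mul, map_add, expPi_add (hint _) (hint _), map_mul]

theorem genericChar_ofAdd (hint : ∀ μ : P, ∃ k : ℤ, (N : ℚ) * ρ μ = k) (μ : P) :
    genericChar ρ hint (.ofAdd μ) = C (expPi N (2 * ρ μ)) * qPow N (-ρ μ) := rfl

theorem specialChar_ofAdd (hint : ∀ μ : P, ∃ k : ℤ, (N : ℚ) * ρ μ = k) (μ : P) :
    specialChar ρ hint (.ofAdd μ) = C (expPi N (ρ μ)) := rfl

theorem isUnit_genericChar (hint : ∀ μ : P, ∃ k : ℤ, (N : ℚ) * ρ μ = k) (μ : Multiplicative P) :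
    IsUnit (genericChar ρ hint μ) :=
  ((isUnit_expPi N _).map C).mul (isUnit_qPow N _)

/-- The ring homomorphism `ℤ[q^{±1/N}] → ℤ[e^{πi/N}][q^{±1/N}]` with `q^{1/N} ↦ e^{πi/N}`. -/
def evalZeta (N : ℕ) : LaurentPolynomial ℤ →+* SignRing N :=
  LaurentPolynomial.eval₂ (Int.castRingHom _)
    (Units.map (C : SignCoeff N →+* SignRing N) (zetaUnit N))

theorem evalZeta_T (N : ℕ) (n : ℤ) :
    evalZeta N (T n) = C ((zetaUnit N ^ n : (SignCoeff N)ˣ) : SignCoeff N) := by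
  rw [evalZeta, LaurentPolynomial.eval₂_T, ← map_zpow]
  rfl

theorem evalZeta_qPow {r : ℚ} (h : ∃ k : ℤ, (N : ℚ) * r = k) :
    evalZeta N (qPow N r) = C (expPi N r) := by
  obtain ⟨k, hk⟩ := h
  rw [qPow_eq hk, expPi_eq hk, evalZeta_T]

end Specializations

end

/-! ### The two sign homomorphisms -/

theorem theorem3p3 {I P : Type*} [Finite I] [AddCommGroup P] [Module.Free ℤ P] [Module.Finite ℤ P]
    (D : KMRootDatum I P)
    (ρ : P →ₗ[ℤ] ℚ) (hρ : ∀ i, ρ (D.coroot i) = 1)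
    (N : ℕ) (hN : 1 ≤ N) (hint : ∀ μ : P, ∃ k : ℤ, (N : ℚ) * ρ μ = k) :
    (∃ sign : D.Hecke N →ₐ[LaurentPolynomial ℤ] SignRing N,
      (∀ i, sign (D.genT N i) = -1) ∧
      (∀ μ : D.titsCone, sign (D.genΘ N μ) =
        LaurentPolynomial.C (expPi N (2 * ρ (μ : P))) * qPow N (-ρ (μ : P))) ∧
      (∀ x, sign (D.basisT ρ N x) = LaurentPolynomial.C (expPi N (D.length ρ x))) ∧
      (∀ (x : D.TitsWeyl) (lam : P) (u l : List I) (h : D.Decomposes x lam u l),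
        sign (D.tExpr ρ N lam h.dominant u l) =
          LaurentPolynomial.C (expPi N (D.length ρ x))) ∧
      (∀ (x : D.TitsWeyl) (n : ℤ), D.length ρ x = n →
        sign (D.basisT ρ N x) = (((-1 : ℤˣ) ^ n : ℤˣ) : ℤ)) ∧
      (∀ g : D.Hecke N →ₐ[LaurentPolynomial ℤ] SignRing N,
        (∀ x, g (D.basisT ρ N x) = LaurentPolynomial.C (expPi N (D.length ρ x))) → g = sign)) ∧
    (∃ sign' : D.Hecke N →+* SignRing N,
      sign' (algebraMap (LaurentPolynomial ℤ) (D.Hecke N) (LaurentPolynomial.T 1)) =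
        LaurentPolynomial.C (expPi N (1 / N)) ∧
      (∀ i, sign' (D.genT N i) = -1) ∧
      (∀ μ : D.titsCone, sign' (D.genΘ N μ) = LaurentPolynomial.C (expPi N (ρ (μ : P)))) ∧
      (∀ x, sign' (D.basisT ρ N x) = LaurentPolynomial.C (expPi N (D.length ρ x))) ∧
      (∀ (x : D.TitsWeyl) (lam : P) (u l : List I) (h : D.Decomposes x lam u l),
        sign' (D.tExpr ρ N lam h.dominant u l) =
          LaurentPolynomial.C (expPi N (D.length ρ x)))) := by
  have hN0 : (N : ℚ) ≠ 0 := by exact_mod_cast (by omega : N ≠ 0)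
  have basis_of_tExpr : ∀ s : D.Hecke N →+* SignRing N,
      (∀ (x : D.TitsWeyl) (lam : P) (u l : List I) (h : D.Decomposes x lam u l),
        s (D.tExpr ρ N lam h.dominant u l) = C (expPi N (D.length ρ x))) →
      ∀ x, s (D.basisT ρ N x) = C (expPi N (D.length ρ x)) := fun s hs x => by
    obtain ⟨lam, u, l, h, -, heq⟩ := D.exists_basisT_eq ρ N x
    rw [heq, hs x lam u l h]
  constructor
  -- `χ(-α_i^∨) = e^{-2πi} q = q`.
  · have hχ : ∀ i, genericChar ρ hint (.ofAdd (-D.coroot i)) =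
        algebraMap (LaurentPolynomial ℤ) (SignRing N) (KMRootDatum.q N) := fun i => by
      rw [KMRootDatum.q, SignRing.algebraMap_T, genericChar_ofAdd, map_neg, hρ, neg_neg,
        qPow_eq (k := N) (by simp), show (2 * -1 : ℚ) = ((2 * -1 : ℤ) : ℚ) by norm_num, expPi_two_mul_intCast hN, map_one,
        one_mul]
    obtain ⟨s, hT, hΘ, hunit⟩ : ∃ s : D.Hecke N →ₐ[LaurentPolynomial ℤ] SignRing N,
        (∀ i, s (D.genT N i) = -1) ∧
        (∀ μ : D.titsCone, s (D.genΘ N μ) = C (expPi N (2 * ρ (μ : P))) * qPow N (-ρ (μ : P))) ∧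
        ∀ μ, IsUnit (s (D.genΘ N μ)) :=
      ⟨D.signHom _ hχ, D.signHom_genT hχ, D.signHom_genΘ hχ, fun μ => by
        rw [D.signHom_genΘ]
        exact isUnit_genericChar ρ hint _⟩
    have htExpr : ∀ (x : D.TitsWeyl) (lam : P) (u l : List I) (h : D.Decomposes x lam u l),
        s (D.tExpr ρ N lam h.dominant u l) =
          C (expPi N (D.length ρ x)) := fun x lam u l h => by
      refine D.map_tExpr_eq_C_expPi (s := (s : D.Hecke N →+* SignRing N))
        hT hρ hN hint (fun μ => ?_) h
      rw [RingHom.coe_coe, AlgHom.commutes, hΘ]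
      obtain ⟨k, hk⟩ := hint μ
      rw [qPow_eq hk, SignRing.algebraMap_T, qPow_eq (k := -k) (by push_cast; rw [← hk]; ring),
        mul_left_comm, ← T_add]
      simp
    have hbasis := basis_of_tExpr (s : D.Hecke N →+* SignRing N) htExpr
    refine ⟨s, hT, hΘ, hbasis, htExpr, fun x n hn => ?_,
      fun g hg => ?_⟩
    · refine (hbasis x).trans ?_
      rw [hn, expPi_intCast hN]
      exact map_intCast (C : SignCoeff N →+* SignRing N) _
    · exact D.algHom_eq_of_basisT_eq ρ hT hunit fun x => (hg x).trans (hbasis x).symm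
  -- Changing the algebra structure to `q^{1/N} ↦ e^{πi/N}` makes the semilinear map an algebra
  -- homomorphism, so `signHom` applies again; now `q` and `χ(-α_i^∨)` both become `-1`.
  · let _ : Algebra (LaurentPolynomial ℤ) (SignRing N) := (evalZeta N).toAlgebra
    have hmap : ∀ a, algebraMap (LaurentPolynomial ℤ) (SignRing N) a = evalZeta N a := fun _ => rfl
    have hχ : ∀ i, specialChar ρ hint (.ofAdd (-D.coroot i)) =
        algebraMap (LaurentPolynomial ℤ) (SignRing N) (KMRootDatum.q N) := fun i => by
      rw [hmap, KMRootDatum.q, evalZeta_T, zpow_natCast, zetaUnit_pow hN,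
        specialChar_ofAdd, map_neg, hρ, show (-1 : ℚ) = ((-1 : ℤ) : ℚ) by norm_num, expPi_intCast hN]
      simp
    obtain ⟨s, hT, hΘ⟩ : ∃ s : D.Hecke N →ₐ[LaurentPolynomial ℤ] SignRing N,
        (∀ i, s (D.genT N i) = -1) ∧
        ∀ μ : D.titsCone, s (D.genΘ N μ) = C (expPi N (ρ (μ : P))) :=
      ⟨D.signHom _ hχ, D.signHom_genT hχ, D.signHom_genΘ hχ⟩
    have htExpr : ∀ (x : D.TitsWeyl) (lam : P) (u l : List I) (h : D.Decomposes x lam u l),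
        s (D.tExpr ρ N lam h.dominant u l) =
          C (expPi N (D.length ρ x)) := fun x lam u l h => by
      refine D.map_tExpr_eq_C_expPi (s := (s : D.Hecke N →+* SignRing N))
        hT hρ hN hint (fun μ => ?_) h
      -- The image of `q^{⟨ρ,μ⟩}` and `χ(μ)` each contribute one factor `e^{πi⟨ρ,μ⟩}`.
      rw [RingHom.coe_coe, AlgHom.commutes, hΘ, hmap, evalZeta_qPow (hint _)]
      rw [← map_mul, ← expPi_add (hint _) (hint _), two_mul]
    refine ⟨(s : D.Hecke N →+* SignRing N), ?_, hT, hΘ,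
      basis_of_tExpr _ htExpr, htExpr⟩
    rw [RingHom.coe_coe, AlgHom.commutes, hmap, evalZeta_T,
      expPi_eq (k := 1) (by rw [mul_one_div_cancel hN0, Int.cast_one])]
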